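/- **Conventions.** Formulas are built from countably many variables with $\land,\lor,\to,\gets,\top,\bot$; put $\neg\varphi:=\varphi\to\bot$, ${\sim}\varphi:=\top\gets\varphi$. A bi-Heyting algebra $\mathbf A$ is a bounded distributive lattice with operations satisfying $c\le a\to b\iff a\land c\le b$ and $a\gets b\le c\iff a\le b\lor c$. A formula $\varphi$ is valid in $\mathbf A$ ($\mathbf A\models\varphi$) if it has value $1$ under every valuation in $\mathbf A$; for a set $L$ of formulas, $\mathbf A$ validates $L$ if it validates every member of $L$. $\mathbf A$ is subdirectly irreducible (SI) if among its congruences other than the identity relation there is a least one. The bi-Esakia dual $\mathbf A_*$ is the set of prime filters of $\mathbf A$ ordered by inclusion, with the topology generated by the sets $\{F: a\in F\}$ ($a\in A$) and their complements. A bi-p-morphism between posets is an order preserving map $f$ such that $f(x)\le y$ implies $y=f(z)$ for some $z\ge x$, and $y\le f(x)$ implies $y=f(z)$ for some $z\le x$; bi-Esakia spaces are isomorphic if there is a bijective continuous bi-p-morphism between them. Finite posets carry the discrete topology. For a finite poset $Y$, $Y^*$ is the bi-Heyting algebra of its upsets, with $\cap$, $\cup$, $U\to V=Y\smallsetminus{\downarrow}(U\smallsetminus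 V)$ and $U\gets V={\uparrow}(U\smallsetminus V)$; and $Y\models\varphi$ means $Y^*\models\varphi$. **Combs.** For $n\ge 1$ the $n$-comb $\mathfrak C_n$ is the poset on $\{x_1,\dots,x_n,x_1',\dots,x_n'\}$ in which $x_i\le x_j$ iff $i\le j$, $x_i'\le x_j$ iff $i\le j$, the $x_i'$ are pairwise incomparable, and never $x_i\le x_j'$. For $n\ge 0$ the $n$-hcomb $\mathfrak C_n'$ is the poset on $\{y_0,\dots,y_n,y_1',\dots,y_n'\}$ with the order given by the same rules. The finite combs are the $\mathfrak C_n$ ($n\ge1$), the finite hcombs are the $\mathfrak C'_n$ ($n\ge 0$), and $Log(FC)$ is the set of formulas valid in every finite comb. **The logic $LFC$.** Bi-intuitionistic logics are the sets of formulas that contain the bi-intuitionistic propositional calculus and are closed under modus ponens, uniform substitution and the rule "from $\varphi$ infer $\neg{\sim}\varphi$"; $L+\Sigma$ is the least one containing $L\cup\Sigma$, and $\mathsf{bi\text{-}GD}$ is the bi-intuitionistic propositional calculus $+\,(p\to q)\lor(q\to p)$. For a finite poset $Y$ with a greatest element whose principal upsets are chains, take pairwise distinct variables $p_U$, $U\in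 Y^*$, and let $\Delta$ be the conjunction of all $p_U\gets p_V$ with $U\not\subseteq V$, let $\Gamma$ be the conjunction of $p_\emptyset\leftrightarrow\bot$, $p_Y\leftrightarrow\top$ and of all $p_{U\star V}\leftrightarrow(p_U\star p_V)$ with $\star\in\{\land,\lor,\to,\gets\}$ and $U,V\in Y^*$, and let $\Gamma_0$ be the conjunction of the latter formulas for $\star\in\{\lor,\gets\}$ only. The Jankov formula of $Y$ is $\mathcal J(Y):=\neg{\sim}\Gamma\to\neg\Delta$ and the subframe formula of $Y$ is $\beta(Y):=\neg{\sim}\Gamma_0\to\neg\Delta$. Put $$LFC:=\mathsf{bi\text{-}GD}+\beta(\mathfrak F_0)+\mathcal J(\mathfrak F_1)+\mathcal J(\mathfrak F_2)+\mathcal J(\mathfrak F_3),$$ where the posets $\mathfrak F_i$ have greatest element $a$ and are generated by the following relations: $\mathfrak F_0=\{a,b,c,d,e\}$ with $d<b<a$, $e<c<a$; $\mathfrak F_1=\{a,b,c\}$ with $c<b<a$; $\mathfrak F_2=\{a,a',b,c,d\}$ with $d<c<b<a$, $a'<a$; $\mathfrak F_3=\{a,b,c,d\}$ with $b,c,d<a$.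 **Proposition.** The finite SI bi-Heyting algebras that validate $Log(FC)$ coincide with the finite SI bi-Heyting algebras that validate $LFC$. Moreover, these are exactly the bi-Heyting algebras $\mathbf A$ whose bi-Esakia dual $\mathbf A_*$ is isomorphic to a finite comb or to a finite hcomb. -/

import Mathlib

universe u v

namespace BiInt

/-! ### Formulas, valuations, validity -/

/-- Formulas in the language `∧, ∨, →, ←, ⊤, ⊥` over the denumerable set of variables `ℕ`. -/
inductive Fm : Type
  | var (n : ℕ) : Fm
  | top : Fm
  | bot : Fm
  | and (φ ψ : Fm) : Fm
  | or (φ ψ : Fm) : Fm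
  | imp (φ ψ : Fm) : Fm
  | coimp (φ ψ : Fm) : Fm

namespace Fm

/-- `¬ φ := φ → ⊥`. -/
def neg (φ : Fm) : Fm := imp φ bot

/-- `∼ φ := ⊤ ← φ`. -/
def coneg (φ : Fm) : Fm := coimp top φ

/-- `φ ↔ ψ`. -/
def iff (φ ψ : Fm) : Fm := and (imp φ ψ) (imp ψ φ)

/-- Uniform substitution. -/
def subst (σ : ℕ → Fm) : Fm → Fm
  | var n => σ n
  | top => top
  | bot => bot
  | and φ ψ => and (subst σ φ) (subst σ ψ)
  | or φ ψ => or (subst σ φ) (subst σ ψ)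
  | imp φ ψ => imp (subst σ φ) (subst σ ψ)
  | coimp φ ψ => coimp (subst σ φ) (subst σ ψ)

/-- The valuation on a bi-Heyting algebra that extends the map `w` on variables. The co-implication
`a ← b` is `a \ b`: it satisfies `a \ b ≤ c ↔ a ≤ b ⊔ c`. -/
def eval {A : Type u} [BiheytingAlgebra A] (w : ℕ → A) : Fm → A
  | var n => w n
  | top => ⊤
  | bot => ⊥
  | and φ ψ => eval w φ ⊓ eval w ψ
  | or φ ψ => eval w φ ⊔ eval w ψ
  | imp φ ψ => eval w φ ⇨ eval w ψ
  | coimp φ ψ => eval w φ \ eval w ψ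

/-- The conjunction of a finite family of formulas. -/
noncomputable def bigAnd {ι : Type u} [Finite ι] (f : ι → Fm) : Fm :=
  ((List.finRange (Nat.card ι)).map fun i => f ((Finite.equivFin ι).symm i)).foldr and top

end Fm

/-- `A ⊨ φ`. -/
def Valid (A : Type u) [BiheytingAlgebra A] (φ : Fm) : Prop :=
  ∀ w : ℕ → A, φ.eval w = ⊤

/-- `A ∈ 𝖵_L`, that is `A ⊨ L`. -/
def InVariety (L : Set Fm) (A : Type u) [BiheytingAlgebra A] : Prop :=
  ∀ φ ∈ L, Valid A φ

/-! ### Bi-intuitionistic logics -/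

/-- Axioms of the intuitionistic propositional calculus (its rules are modus ponens and uniform
substitution). -/
def ipcAxioms : Set Fm :=
  let p := Fm.var 0
  let q := Fm.var 1
  let r := Fm.var 2
  { .imp p (.imp q p),
    .imp (.imp p (.imp q r)) (.imp (.imp p q) (.imp p r)),
    .imp (.and p q) p,
    .imp (.and p q) q,
    .imp p (.imp q (.and p q)),
    .imp p (.or p q),
    .imp q (.or p q),
    .imp (.imp p r) (.imp (.imp q r) (.imp (.or p q) r)),
    .imp .bot p,
    .top }

/-- The eight additional axioms of the bi-intuitionistic propositional calculus. -/
def coimpAxioms : Set Fm :=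
  let p := Fm.var 0
  let q := Fm.var 1
  let r := Fm.var 2
  { .imp p (.or q (.coimp p q)),
    .imp (.coimp p q) (.coneg (.imp p q)),
    .imp (.coimp (.coimp p q) r) (.coimp p (.or q r)),
    .imp (.neg (.coimp p q)) (.imp p q),
    .imp (.imp p (.coimp q q)) (.neg p),
    .imp (.neg p) (.imp p (.coimp q q)),
    .imp (.coimp (.imp p p) q) (.coneg q),
    .imp (.coneg q) (.coimp (.imp p p) q) }

/-- The least set of formulas which contains the axioms of the bi-intuitionistic propositional
calculus and the set `S`, and is closed under modus ponens, uniform substitution, and the double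
negation rule "from `φ` infer `¬ ∼ φ`". -/
inductive Derivable (S : Set Fm) : Fm → Prop
  | ipc {φ : Fm} (h : φ ∈ ipcAxioms) : Derivable S φ
  | coimp {φ : Fm} (h : φ ∈ coimpAxioms) : Derivable S φ
  | ax {φ : Fm} (h : φ ∈ S) : Derivable S φ
  | mp {φ ψ : Fm} (h₁ : Derivable S (.imp φ ψ)) (h₂ : Derivable S φ) : Derivable S ψ
  | subst {φ : Fm} (σ : ℕ → Fm) (h : Derivable S φ) : Derivable S (φ.subst σ)
  | dn {φ : Fm} (h : Derivable S φ) : Derivable S φ.coneg.neg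

/-- The bi-intuitionistic propositional calculus `bi-IPC`. -/
def biIPC : Set Fm := {φ | Derivable ∅ φ}

/-- `L + S`, the least bi-intuitionistic logic containing `L ∪ S`. -/
def extend (L S : Set Fm) : Set Fm := {φ | Derivable (L ∪ S) φ}

/-- The bi-intuitionistic Gödel-Dummett logic `bi-GD = bi-IPC + (p → q) ∨ (q → p)`. -/
def biGD : Set Fm :=
  extend biIPC {.or (.imp (.var 0) (.var 1)) (.imp (.var 1) (.var 0))}

/-! ### Subdirectly irreducible algebras -/

/-- `r` is a congruence of the bi-Heyting algebra `A`. -/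
structure IsCongruence {A : Type u} [BiheytingAlgebra A] (r : Setoid A) : Prop where
  inf {a b c d : A} : r a b → r c d → r (a ⊓ c) (b ⊓ d)
  sup {a b c d : A} : r a b → r c d → r (a ⊔ c) (b ⊔ d)
  himp {a b c d : A} : r a b → r c d → r (a ⇨ c) (b ⇨ d)
  sdiff {a b c d : A} : r a b → r c d → r (a \ c) (b \ d)

/-- `A` is subdirectly irreducible: its congruence lattice has a second least element, that is,
there is a least congruence among those distinct from the identity relation `⊥`. -/
def IsSI (A : Type u) [BiheytingAlgebra A] : Prop :=
  ∃ r : Setoid A, IsLeast {s : Setoid A | IsCongruence s ∧ s ≠ ⊥} r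

/-- `A` is a finite subdirectly irreducible member of the variety of `L`. -/
def InFinSI (L : Set Fm) (A : Type u) [BiheytingAlgebra A] : Prop :=
  InVariety L A ∧ IsSI A ∧ Finite A

/-! ### Bi-Esakia duals -/

/-- The bi-Esakia dual of `A`: its prime filters, ordered by inclusion. -/
def Dual (A : Type u) [BiheytingAlgebra A] : Type u :=
  {F : Order.PFilter A // F.IsPrime}

instance (A : Type u) [BiheytingAlgebra A] : PartialOrder (Dual A) :=
  inferInstanceAs (PartialOrder {F : Order.PFilter A // F.IsPrime})

/-- The set of the prime filters which contain `a`. -/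
def Dual.basic {A : Type u} [BiheytingAlgebra A] (a : A) : Set (Dual A) :=
  {F | a ∈ F.1}

/-- The topology generated by the sets of the form `basic a` and their complements. -/
instance (A : Type u) [BiheytingAlgebra A] : TopologicalSpace (Dual A) :=
  TopologicalSpace.generateFrom
    (Set.range (Dual.basic (A := A)) ∪ Set.range fun a : A => (Dual.basic a)ᶜ)

/-- Bi-p-morphisms between posets. -/
structure IsBiPMorphism {X : Type u} {Y : Type v} [PartialOrder X] [PartialOrder Y]
    (f : X → Y) : Prop where
  mono : ∀ x z : X, x ≤ z → f x ≤ f z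
  up : ∀ (x : X) (y : Y), f x ≤ y → ∃ z : X, x ≤ z ∧ f z = y
  down : ∀ (x : X) (y : Y), y ≤ f x → ∃ z : X, z ≤ x ∧ f z = y

/-- `X ≅ Y` for bi-Esakia spaces: there is a bijective bi-Esakia morphism (that is, a bijective
continuous bi-p-morphism) between them. -/
def Isomorphic (X : Type u) (Y : Type v) [PartialOrder X] [TopologicalSpace X]
    [PartialOrder Y] [TopologicalSpace Y] : Prop :=
  ∃ f : X → Y, Function.Bijective f ∧ Continuous f ∧ IsBiPMorphism f

/-- The upsets of a poset, ordered by inclusion. If `X` is a finite poset, viewed as a bi-Esakia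
space with the discrete topology, these are its clopen upsets. -/
@[ext] structure Up (X : Type u) [PartialOrder X] where
  carrier : Set X
  upper : IsUpperSet carrier

namespace Up

variable {X : Type u} [PartialOrder X]

theorem carrier_injective : Function.Injective (carrier : Up X → Set X) :=
  fun _ _ h => Up.ext h

instance : PartialOrder (Up X) := PartialOrder.lift carrier carrier_injective

instance [Finite X] : Finite (Up X) := Finite.of_injective _ (carrier_injective (X := X))

/-- The algebraic dual `X^*` of a finite poset `X`: meets and joins are intersections and unions,
`U → V = X \ ↓(U \ V)` and `U ← V = ↑(U \ V)`. -/
instance : BiheytingAlgebra (Up X) where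
  sup U V := ⟨U.carrier ∪ V.carrier, U.upper.union V.upper⟩
  inf U V := ⟨U.carrier ∩ V.carrier, U.upper.inter V.upper⟩
  top := ⟨Set.univ, isUpperSet_univ⟩
  bot := ⟨∅, isUpperSet_empty⟩
  himp U V := ⟨{x | ∀ y, x ≤ y → y ∈ U.carrier → y ∈ V.carrier},
    fun _ _ hab h y hy => h y (hab.trans hy)⟩
  sdiff U V := ⟨{x | ∃ y, y ≤ x ∧ y ∈ U.carrier ∧ y ∉ V.carrier},
    fun _ _ hab ⟨y, hy, h⟩ => ⟨y, hy.trans hab, h⟩⟩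
  compl U := ⟨{x | ∀ y, x ≤ y → y ∉ U.carrier}, fun _ _ hab h y hy => h y (hab.trans hy)⟩
  hnot U := ⟨{x | ∃ y, y ≤ x ∧ y ∉ U.carrier}, fun _ _ hab ⟨y, hy, h⟩ => ⟨y, hy.trans hab, h⟩⟩
  le_sup_left _ _ _ h := Or.inl h
  le_sup_right _ _ _ h := Or.inr h
  sup_le _ _ _ h₁ h₂ _ h := h.elim (fun h => h₁ h) (fun h => h₂ h)
  inf_le_left _ _ _ h := h.1
  inf_le_right _ _ _ h := h.2
  le_inf _ _ _ h₁ h₂ _ h := ⟨h₁ h, h₂ h⟩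
  le_top _ _ _ := trivial
  bot_le _ _ h := h.elim
  le_himp_iff U _ _ := ⟨fun h _ hx => h hx.1 _ le_rfl hx.2,
    fun h _ hx _ hy hyV => h ⟨U.upper hy hx, hyV⟩⟩
  himp_bot _ := rfl
  sdiff_le_iff U V W := by
    constructor
    · intro h x hx
      by_cases hV : x ∈ V.carrier
      · exact Or.inl hV
      · exact Or.inr (h ⟨x, le_rfl, hx, hV⟩)
    · rintro h x ⟨y, hyx, hyU, hyV⟩
      exact W.upper hyx ((h hyU).resolve_left hyV)
  top_sdiff U := by
    ext x
    exact ⟨fun ⟨y, h, _, h'⟩ => ⟨y, h, h'⟩, fun ⟨y, h, h'⟩ => ⟨y, h, trivial, h'⟩⟩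

end Up

/-! ### Jankov and subframe formulas -/

section Jankov

variable (A : Type u) [BiheytingAlgebra A] [Finite A]

/-- A variable `p_a` for each element `a` of the finite algebra `A`. -/
noncomputable def pvar (a : A) : Fm := .var (Finite.equivFin A a)

/-- `⋀ {p_{a ∨ b} ↔ p_a ∨ p_b} ∧ ⋀ {p_{a ← b} ↔ (p_a ← p_b)}`. -/
noncomputable def joinCoimpDiagram : Fm :=
  .and (.bigAnd fun x : A × A => .iff (pvar A (x.1 ⊔ x.2)) (.or (pvar A x.1) (pvar A x.2)))
    (.bigAnd fun x : A × A => .iff (pvar A (x.1 \ x.2)) (.coimp (pvar A x.1) (pvar A x.2)))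

/-- The formula that describes all the operations of `A`. -/
noncomputable def diagram : Fm :=
  .and (joinCoimpDiagram A) <|
  .and (.bigAnd fun x : A × A => .iff (pvar A (x.1 ⊓ x.2)) (.and (pvar A x.1) (pvar A x.2))) <|
  .and (.bigAnd fun x : A × A => .iff (pvar A (x.1 ⇨ x.2)) (.imp (pvar A x.1) (pvar A x.2))) <|
  .and (.iff (pvar A ⊥) .bot) (.iff (pvar A ⊤) .top)

/-- `⋀ {p_a ← p_b : a ≰ b}`. -/
noncomputable def separation : Fm :=
  .bigAnd fun x : {x : A × A // ¬ x.1 ≤ x.2} => .coimp (pvar A x.1.1) (pvar A x.1.2)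

/-- The Jankov formula of a finite subdirectly irreducible bi-Gödel algebra. -/
noncomputable def algJankov : Fm := .imp (diagram A).coneg.neg (separation A).neg

/-- The subframe formula of a finite subdirectly irreducible bi-Gödel algebra. -/
noncomputable def algSubframe : Fm := .imp (joinCoimpDiagram A).coneg.neg (separation A).neg

end Jankov

/-- The Jankov formula of a finite co-tree `Y`. -/
noncomputable def jankov (Y : Type u) [PartialOrder Y] [Finite Y] : Fm := algJankov (Up Y)

/-- The subframe formula of a finite co-tree `Y`. -/
noncomputable def subframe (Y : Type u) [PartialOrder Y] [Finite Y] : Fm := algSubframe (Up Y)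

/-! ### The four co-trees -/

/-- The co-tree with co-root `a` and the two branches `d < b < a` and `e < c < a`. -/
inductive F0 : Type
  | a | b | c | d | e
  deriving DecidableEq

instance : Fintype F0 where
  elems := {.a, .b, .c, .d, .e}
  complete x := by cases x <;> decide

instance : PartialOrder F0 where
  le x y := x = y ∨ y = .a ∨ (x = .d ∧ y = .b) ∨ (x = .e ∧ y = .c)
  le_refl _ := Or.inl rfl
  le_trans := by decide
  le_antisymm := by decide

/-- The three-element chain `c < b < a`. -/
inductive F1 : Type
  | a | b | c
  deriving DecidableEq

instance : Fintype F1 where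
  elems := {.a, .b, .c}
  complete x := by cases x <;> decide

instance : PartialOrder F1 where
  le x y := x = y ∨ y = .a ∨ (x = .c ∧ y = .b)
  le_refl _ := Or.inl rfl
  le_trans := by decide
  le_antisymm := by decide

/-- The co-tree with co-root `a` and the two branches `d < c < b < a` and `a' < a`. -/
inductive F2 : Type
  | a | a' | b | c | d
  deriving DecidableEq

instance : Fintype F2 where
  elems := {.a, .a', .b, .c, .d}
  complete x := by cases x <;> decide

instance : PartialOrder F2 where
  le x y := x = y ∨ y = .a ∨ (x = .d ∧ y = .c) ∨ (x = .d ∧ y = .b) ∨ (x = .c ∧ y = .b)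
  le_refl _ := Or.inl rfl
  le_trans := by decide
  le_antisymm := by decide

/-- The co-tree with co-root `a` and three minimal points `b, c, d` below it. -/
inductive F3 : Type
  | a | b | c | d
  deriving DecidableEq

instance : Fintype F3 where
  elems := {.a, .b, .c, .d}
  complete x := by cases x <;> decide

instance : PartialOrder F3 where
  le x y := x = y ∨ y = .a
  le_refl _ := Or.inl rfl
  le_trans := by decide
  le_antisymm := by decide

/-- `LFC = bi-GD + β(F0) + J(F1) + J(F2) + J(F3)`. -/
noncomputable def LFC : Set Fm :=
  extend biGD {subframe F0, jankov F1, jankov F2, jankov F3}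

/-! ### Combs -/

/-- The points of the `n`-comb: `spine i` is `x_{i+1}` and `tooth i` is `x_{i+1}'`. -/
inductive Comb (n : ℕ) : Type
  | spine (i : Fin n) : Comb n
  | tooth (i : Fin n) : Comb n

namespace Comb

variable {n : ℕ}

/-- `x_i ≤ x_j` iff `i ≤ j`; `x_i' ≤ x_j` iff `i ≤ j`; `x_i' ≤ x_j'` iff `i = j`;
and never `x_i ≤ x_j'`. -/
def le : Comb n → Comb n → Prop
  | spine i, spine j => i ≤ j
  | tooth i, spine j => i ≤ j
  | tooth i, tooth j => i = j
  | spine _, tooth _ => False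

instance : PartialOrder (Comb n) where
  le := le
  le_refl x := by cases x <;> simp [le]
  le_trans x y z := by cases x <;> cases y <;> cases z <;> simp only [le] <;> grind
  le_antisymm x y := by cases x <;> cases y <;> simp only [le] <;> grind

instance : TopologicalSpace (Comb n) := ⊥

end Comb

/-- The points of the `n`-hcomb: `spine i` is `y_i` (`0 ≤ i ≤ n`) and `tooth i` is `y_{i+1}'`. -/
inductive HComb (n : ℕ) : Type
  | spine (i : Fin (n + 1)) : HComb n
  | tooth (i : Fin n) : HComb n

namespace HComb

variable {n : ℕ}

/-- `y_i ≤ y_j` iff `i ≤ j`; `y_i' ≤ y_j` iff `i ≤ j`; `y_i' ≤ y_j'` iff `i = j`;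
and never `y_i ≤ y_j'`. -/
def le : HComb n → HComb n → Prop
  | spine i, spine j => i ≤ j
  | tooth i, spine j => i.succ ≤ j
  | tooth i, tooth j => i = j
  | spine _, tooth _ => False

instance : PartialOrder (HComb n) where
  le := le
  le_refl x := by cases x <;> simp [le]
  le_trans x y z := by cases x <;> cases y <;> cases z <;> simp only [le] <;> grind
  le_antisymm x y := by cases x <;> cases y <;> simp only [le] <;> grind

instance : TopologicalSpace (HComb n) := ⊥

end HComb

/-- `Log(FC)`, the logic of the finite combs. -/
def LogFC : Set Fm := {φ | ∀ n : ℕ, 0 < n → Valid (Up (Comb n)) φ}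

end BiInt

namespace BiInt

/-! ### Homomorphisms and soundness -/

/-! The proof closes a circle: validating `LogFC` implies validating `LFC`, a finite SI algebra
validating `LFC` has a comb or an hcomb as dual, and the upsets of combs and hcombs form finite SI
algebras validating `LogFC`.

Everything is read on finite posets, since an algebra with a finite dual is the algebra of upsets of
that dual (`Dual.orderIsoUp`). The Gödel-Dummett axiom says that principal upsets are chains; under
it, SI gives a greatest element. Over a poset with a greatest element, `jankov Y` is refuted exactly
when there is a surjective bi-p-morphism onto `Y`, and `subframe Y` is refuted as soon as `Y` embeds
as a poset.

Combs satisfy the axioms because each point that is not minimal has a minimal lower cover, its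
tooth, and because such points form a chain. An hcomb is the bi-p-morphic image of a comb under
gluing the two lowest points, so it inherits `LogFC`.

Conversely, let the four axioms hold in a finite poset with a greatest element whose principal
upsets are chains. Omitting `F0` makes the non-minimal points a chain, the spine. Omitting `F1` and
`F2` gives every spine point a minimal lower cover, its tooth. Omitting `F3` leaves room for at most
one further minimal point, and only below the whole spine. Without such a point the poset is a comb,
with it an hcomb (`comb_or_hcomb`). -/

theorem Fm.eval_map {A : Type u} {B : Type v} [BiheytingAlgebra A] [BiheytingAlgebra B]
    (f : BiheytingHom A B) (w : ℕ → A) (φ : Fm) : φ.eval (f ∘ w) = f (φ.eval w) := by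
  induction φ with
  | var n => rfl
  | top => exact (map_top f).symm
  | bot => exact (map_bot f).symm
  | and φ ψ h₁ h₂ => simp only [Fm.eval, h₁, h₂, map_inf]
  | or φ ψ h₁ h₂ => simp only [Fm.eval, h₁, h₂, map_sup]
  | imp φ ψ h₁ h₂ => simp only [Fm.eval, h₁, h₂, map_himp]
  | coimp φ ψ h₁ h₂ => simp only [Fm.eval, h₁, h₂, map_sdiff]

theorem Valid.of_injective {A : Type u} {B : Type v} [BiheytingAlgebra A] [BiheytingAlgebra B]
    (f : BiheytingHom A B) (hf : Function.Injective f) {φ : Fm} (h : Valid B φ) : Valid A φ := by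
  intro w
  apply hf
  rw [← Fm.eval_map, h, map_top]

theorem Valid.of_orderIso {A : Type u} {B : Type v} [BiheytingAlgebra A] [BiheytingAlgebra B]
    (e : A ≃o B) {φ : Fm} (h : Valid B φ) : Valid A φ :=
  h.of_injective (e : BiheytingHom A B) e.injective

theorem Fm.eval_subst {A : Type u} [BiheytingAlgebra A] (σ : ℕ → Fm) (w : ℕ → A) (φ : Fm) :
    (φ.subst σ).eval w = φ.eval fun n => (σ n).eval w := by
  induction φ with
  | var n => rfl
  | top => rfl
  | bot => rfl
  | and φ ψ h₁ h₂ => simp only [Fm.subst, Fm.eval, h₁, h₂]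
  | or φ ψ h₁ h₂ => simp only [Fm.subst, Fm.eval, h₁, h₂]
  | imp φ ψ h₁ h₂ => simp only [Fm.subst, Fm.eval, h₁, h₂]
  | coimp φ ψ h₁ h₂ => simp only [Fm.subst, Fm.eval, h₁, h₂]

theorem valid_of_mem_ipcAxioms {A : Type u} [BiheytingAlgebra A] {φ : Fm} (h : φ ∈ ipcAxioms) :
    Valid A φ := by
  intro w
  simp only [ipcAxioms, Set.mem_insert_iff, Set.mem_singleton_iff] at h
  rcases h with rfl | rfl | rfl | rfl | rfl | rfl | rfl | rfl | rfl | rfl <;>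
    simp only [Fm.eval, himp_eq_top_iff, inf_le_left, inf_le_right, le_sup_left, le_sup_right,
      bot_le]
  · exact le_himp
  · rw [le_himp_iff, le_himp_iff]
    have h₁ : (w 0 ⇨ w 1 ⇨ w 2) ⊓ (w 0 ⇨ w 1) ⊓ w 0 ≤ w 1 :=
      (inf_le_inf_right _ inf_le_right).trans himp_inf_le
    have h₂ : (w 0 ⇨ w 1 ⇨ w 2) ⊓ (w 0 ⇨ w 1) ⊓ w 0 ≤ w 1 ⇨ w 2 :=
      (inf_le_inf_right _ inf_le_left).trans himp_inf_le
    exact (le_inf h₂ h₁).trans himp_inf_le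
  · rw [le_himp_iff]
  · rw [le_himp_iff, sup_himp_distrib]

theorem valid_of_mem_coimpAxioms {A : Type u} [BiheytingAlgebra A] {φ : Fm}
    (h : φ ∈ coimpAxioms) : Valid A φ := by
  intro w
  simp only [coimpAxioms, Set.mem_insert_iff, Set.mem_singleton_iff] at h
  rcases h with rfl | rfl | rfl | rfl | rfl | rfl | rfl | rfl <;>
    simp only [Fm.eval, Fm.neg, Fm.coneg, himp_eq_top_iff, himp_self, sdiff_self]
  · exact le_sup_sdiff
  · rw [sdiff_le_iff]
    have h₁ : w 0 ≤ (w 0 ⇨ w 1) ⊔ ⊤ \ (w 0 ⇨ w 1) := le_top.trans le_sup_sdiff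
    calc w 0 ≤ w 0 ⊓ ((w 0 ⇨ w 1) ⊔ ⊤ \ (w 0 ⇨ w 1)) := le_inf le_rfl h₁
      _ = w 0 ⊓ (w 0 ⇨ w 1) ⊔ w 0 ⊓ ⊤ \ (w 0 ⇨ w 1) := inf_sup_left _ _ _
      _ ≤ w 1 ⊔ ⊤ \ (w 0 ⇨ w 1) := sup_le_sup inf_himp_le inf_le_right
  · rw [sdiff_sdiff_left]
  · rw [le_himp_iff]
    calc (w 0 \ w 1 ⇨ ⊥) ⊓ w 0 ≤ (w 0 \ w 1 ⇨ ⊥) ⊓ (w 1 ⊔ w 0 \ w 1) :=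
          inf_le_inf_left _ le_sup_sdiff
      _ = (w 0 \ w 1 ⇨ ⊥) ⊓ w 1 ⊔ (w 0 \ w 1 ⇨ ⊥) ⊓ w 0 \ w 1 := inf_sup_left _ _ _
      _ ≤ w 1 := sup_le inf_le_right (himp_inf_le.trans bot_le)

theorem Derivable.valid {A : Type u} [BiheytingAlgebra A] {S : Set Fm} (hS : InVariety S A)
    {φ : Fm} (h : Derivable S φ) : Valid A φ := by
  induction h with
  | ipc h => exact valid_of_mem_ipcAxioms h
  | coimp h => exact valid_of_mem_coimpAxioms h
  | ax h => exact hS _ h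
  | mp _ _ h₁ h₂ =>
    intro w
    have := h₁ w
    rwa [Fm.eval, h₂ w, top_himp] at this
  | subst σ _ h => exact fun w => (Fm.eval_subst σ w _).trans (h _)
  | dn _ h =>
    intro w
    simp only [Fm.neg, Fm.coneg, Fm.eval, h w, sdiff_self, himp_self]

/-- By soundness, validity of a logic only has to be tested on its generators; this turns membership
in `LFC` into conditions on five axioms. -/
theorem inVariety_extend_iff {A : Type u} [BiheytingAlgebra A] {L S : Set Fm} :
    InVariety (extend L S) A ↔ InVariety L A ∧ InVariety S A := by
  refine ⟨fun h => ⟨fun φ hφ => h φ (.ax (.inl hφ)), fun φ hφ => h φ (.ax (.inr hφ))⟩, ?_⟩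
  rintro ⟨h₁, h₂⟩ φ hφ
  exact Derivable.valid (fun ψ hψ => hψ.elim (h₁ ψ) (h₂ ψ)) hφ

theorem inVariety_biGD_iff {A : Type u} [BiheytingAlgebra A] :
    InVariety biGD A ↔ ∀ a b : A, (a ⇨ b) ⊔ (b ⇨ a) = ⊤ := by
  rw [biGD, inVariety_extend_iff]
  constructor
  · intro h a b
    exact h.2 _ rfl fun n => if n = 0 then a else b
  · intro h
    refine ⟨fun φ hφ => Derivable.valid (fun _ h => h.elim) hφ, ?_⟩
    rintro _ rfl w
    exact h _ _

/-! ### Subdirect irreducibility -/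

theorem IsSI.of_orderIso {A : Type u} {B : Type v} [BiheytingAlgebra A] [BiheytingAlgebra B]
    (e : A ≃o B) (h : IsSI A) : IsSI B := by
  obtain ⟨r, ⟨hr, hr0⟩, hmin⟩ := h
  refine ⟨r.comap e.symm, ⟨⟨?_, ?_, ?_, ?_⟩, ?_⟩, ?_⟩
  · intro a b c d h₁ h₂
    simpa only [Setoid.comap_rel, map_inf] using hr.inf h₁ h₂
  · intro a b c d h₁ h₂
    simpa only [Setoid.comap_rel, map_sup] using hr.sup h₁ h₂
  · intro a b c d h₁ h₂
    simpa only [Setoid.comap_rel, map_himp] using hr.himp h₁ h₂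
  · intro a b c d h₁ h₂
    simpa only [Setoid.comap_rel, map_sdiff] using hr.sdiff h₁ h₂
  · intro h
    apply hr0
    ext a b
    have : r.comap e.symm (e a) (e b) ↔ (⊥ : Setoid B) (e a) (e b) := by rw [h]
    simpa [Setoid.comap_rel, Setoid.bot_def] using this
  · rintro s ⟨hs, hs0⟩ a b hab
    have hmem : s.comap e ∈ {s : Setoid A | IsCongruence s ∧ s ≠ ⊥} := by
      refine ⟨⟨?_, ?_, ?_, ?_⟩, ?_⟩
      · intro a b c d h₁ h₂
        simpa only [Setoid.comap_rel, map_inf] using hs.inf h₁ h₂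
      · intro a b c d h₁ h₂
        simpa only [Setoid.comap_rel, map_sup] using hs.sup h₁ h₂
      · intro a b c d h₁ h₂
        simpa only [Setoid.comap_rel, map_himp] using hs.himp h₁ h₂
      · intro a b c d h₁ h₂
        simpa only [Setoid.comap_rel, map_sdiff] using hs.sdiff h₁ h₂
      · intro h
        apply hs0
        ext a b
        have : s.comap e (e.symm a) (e.symm b) ↔ (⊥ : Setoid A) (e.symm a) (e.symm b) := by rw [h]
        simpa [Setoid.comap_rel, Setoid.bot_def] using this
    simpa [Setoid.comap_rel] using hmin hmem hab

theorem InFinSI.of_orderIso {A : Type u} {B : Type v} [BiheytingAlgebra A] [BiheytingAlgebra B]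
    (e : A ≃o B) {L : Set Fm} (h : InFinSI L A) : InFinSI L B :=
  have := h.2.2
  ⟨fun φ hφ => (h.1 φ hφ).of_orderIso e.symm, h.2.1.of_orderIso e, .of_equiv A e.toEquiv⟩

namespace Up

variable {X : Type u} [PartialOrder X] {U V : Up X} {x : X}

theorem le_iff : U ≤ V ↔ ∀ x ∈ U.carrier, x ∈ V.carrier := Iff.rfl

@[simp] theorem mem_top : x ∈ (⊤ : Up X).carrier := trivial

@[simp] theorem notMem_bot : x ∉ (⊥ : Up X).carrier := id

theorem mem_inf : x ∈ (U ⊓ V).carrier ↔ x ∈ U.carrier ∧ x ∈ V.carrier := Iff.rfl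

theorem mem_sup : x ∈ (U ⊔ V).carrier ↔ x ∈ U.carrier ∨ x ∈ V.carrier := Iff.rfl

theorem mem_himp : x ∈ (U ⇨ V).carrier ↔ ∀ y, x ≤ y → y ∈ U.carrier → y ∈ V.carrier := Iff.rfl

theorem mem_sdiff : x ∈ (U \ V).carrier ↔ ∃ y, y ≤ x ∧ y ∈ U.carrier ∧ y ∉ V.carrier := Iff.rfl

/-- The principal upset of a point. -/
def principal (x : X) : Up X := ⟨Set.Ici x, isUpperSet_Ici x⟩

@[simp] theorem mem_principal {y : X} : y ∈ (principal x).carrier ↔ x ≤ y := Iff.rfl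

theorem principal_le : principal x ≤ U ↔ x ∈ U.carrier :=
  ⟨fun h => h le_rfl, fun h _ hy => U.upper hy h⟩

theorem eq_of_forall (h : ∀ x, x ∈ U.carrier ↔ x ∈ V.carrier) : U = V := Up.ext (Set.ext h)

end Up

/-- Such an algebra is even simple. A nonempty upset contains `t`, so its pseudocomplement is `⊥`.
If a congruence relates `U` and `V` with `U ≰ V`, it relates the nonempty `U \ V` to `⊥`, hence,
taking pseudocomplements, `⊥` to `⊤`, and then everything is related. -/
theorem isSI_up_of_greatest {X : Type u} [PartialOrder X] {t : X} (ht : ∀ x, x ≤ t) :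
    IsSI (Up X) := by
  have hbt : (⊥ : Up X) ≠ ⊤ := fun h => by
    have : t ∈ (⊥ : Up X).carrier := by rw [h]; trivial
    exact this
  refine ⟨⊤, ⟨⟨?_, ?_, ?_, ?_⟩, fun h => ?_⟩, ?_⟩
  iterate 4 exact fun _ _ => trivial
  · have : (⊥ : Setoid (Up X)) ⊥ ⊤ := by rw [← h]; trivial
    exact hbt this
  · rintro s ⟨hs, hs0⟩
    have key : ∀ U V : Up X, s U V → ¬ U ≤ V → s ⊤ ⊥ := by
      intro U V hUV hle
      have h₁ : s (U \ V) ⊥ := by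
        have := hs.sdiff hUV (s.refl V)
        rwa [sdiff_self] at this
      have h₂ : (U \ V) ⇨ ⊥ = (⊥ : Up X) := by
        refine Up.eq_of_forall fun x => ⟨fun h => ?_, fun h => h.elim⟩
        obtain ⟨y, hyU, hyV⟩ : ∃ y ∈ U.carrier, y ∉ V.carrier := by
          simpa [Up.le_iff] using hle
        exact h t (ht x) ⟨y, ht y, hyU, hyV⟩
      have h₃ := hs.himp h₁ (s.refl ⊥)
      rw [h₂, himp_self] at h₃
      exact s.symm h₃
    have hbot : s ⊤ ⊥ := by
      by_contra hn
      refine hs0 (le_antisymm (fun U V hUV => ?_) bot_le)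
      have h₁ : U ≤ V := not_not.1 fun h => hn (key U V hUV h)
      have h₂ : V ≤ U := not_not.1 fun h => hn (key V U (s.symm hUV) h)
      exact le_antisymm h₁ h₂
    have all : ∀ U : Up X, s U ⊥ := fun U => by
      have := hs.inf (s.refl U) hbot
      rwa [inf_top_eq, inf_bot_eq] at this
    exact fun U V _ => s.trans (all U) (s.symm (all V))

/-- The congruence of `Up X` which identifies the upsets that agree on `C`. -/
def agreeOn {X : Type u} [PartialOrder X] (C : Set X) : Setoid (Up X) where
  r U V := ∀ x ∈ C, x ∈ U.carrier ↔ x ∈ V.carrier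
  iseqv := ⟨fun _ _ _ => Iff.rfl, fun h x hx => (h x hx).symm,
    fun h₁ h₂ x hx => (h₁ x hx).trans (h₂ x hx)⟩

/-- Membership of a point in `U ⇨ V` depends only on the points above it, and in `U \ V` only on
those below it. A set closed in both directions therefore sees all operations. -/
theorem isCongruence_agreeOn {X : Type u} [PartialOrder X] {C : Set X} (hu : IsUpperSet C)
    (hl : IsLowerSet C) : IsCongruence (agreeOn C) where
  inf h₁ h₂ x hx := and_congr (h₁ x hx) (h₂ x hx)
  sup h₁ h₂ x hx := or_congr (h₁ x hx) (h₂ x hx)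
  himp h₁ h₂ _ hx := forall_congr' fun y => forall_congr' fun hy =>
    imp_congr (h₁ y (hu hy hx)) (h₂ y (hu hy hx))
  sdiff h₁ h₂ _ hx := exists_congr fun y => and_congr_right fun hy =>
    and_congr (h₁ y (hl hy hx)) (not_congr (h₂ y (hl hy hx)))

/-- For a maximal `t`, the chain condition makes `↓t` an upset as well as a downset. If some `z` lay
outside, agreement on `↓t` and agreement on its complement would be two congruences, both different
from the identity, whose intersection is the identity; no least congruence could then lie below
both. -/
theorem exists_greatest_of_isSI {X : Type u} [PartialOrder X] [Finite X]
    (hX : ∀ x y z : X, x ≤ y → x ≤ z → y ≤ z ∨ z ≤ y) (h : IsSI (Up X)) :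
    ∃ t : X, ∀ x, x ≤ t := by
  obtain ⟨r, ⟨-, hr0⟩, hmin⟩ := h
  have hne : Nonempty X := by
    by_contra hX
    rw [not_nonempty_iff] at hX
    exact hr0 (le_antisymm (fun U V _ => Up.eq_of_forall fun x => hX.elim x) bot_le)
  obtain ⟨t, -, ht⟩ := (Set.toFinite (Set.univ : Set X)).exists_maximal Set.univ_nonempty
  have ht : ∀ x, t ≤ x → x ≤ t := fun x hx => ht trivial hx
  have hu : IsUpperSet (Set.Iic t) := fun x y hxy hx => by
    rcases hX x t y hx hxy with h | h
    exacts [ht y h, h]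
  have hl : IsLowerSet (Set.Iic t) := isLowerSet_Iic t
  refine ⟨t, fun z => not_not.1 fun hz => hr0 ?_⟩
  have h₁ : r ≤ agreeOn (Set.Iic t) := by
    refine hmin ⟨isCongruence_agreeOn hu hl, fun h => ?_⟩
    have : agreeOn (Set.Iic t) ⟨(Set.Iic t)ᶜ, hl.compl⟩ ⊥ :=
      fun x hx => ⟨fun h => h hx, fun h => h.elim⟩
    rw [h] at this
    have hz' : z ∈ (⊥ : Up X).carrier := (congrArg Up.carrier this).subset hz
    exact hz'
  have h₂ : r ≤ agreeOn (Set.Iic t)ᶜ := by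
    refine hmin ⟨isCongruence_agreeOn hl.compl hu.compl, fun h => ?_⟩
    have : agreeOn (Set.Iic t)ᶜ ⟨Set.Iic t, hu⟩ ⊥ :=
      fun x hx => ⟨fun h => hx h, fun h => h.elim⟩
    rw [h] at this
    have hz' : t ∈ (⊥ : Up X).carrier := (congrArg Up.carrier this).subset le_rfl
    exact hz'
  refine le_antisymm (fun U V hUV => Up.eq_of_forall fun x => ?_) bot_le
  by_cases hx : x ∈ Set.Iic t
  exacts [h₁ hUV x hx, h₂ hUV x hx]

/-! ### Duality -/

namespace Dual

variable {A : Type u} [BiheytingAlgebra A]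

theorem bot_notMem (F : Dual A) : ⊥ ∉ F.1 := by
  have h := F.2.toPrimePair.I.bot_mem
  have hc := F.2.toPrimePair.compl_F_eq_I
  intro hF
  have : (⊥ : A) ∈ ((F.2.toPrimePair.F : Set A))ᶜ := by rw [hc]; exact h
  exact this hF

theorem sup_mem_iff (F : Dual A) {a b : A} : a ⊔ b ∈ F.1 ↔ a ∈ F.1 ∨ b ∈ F.1 := by
  constructor
  · intro h
    by_contra! hn
    have hc := F.2.toPrimePair.compl_F_eq_I
    have ha : a ∈ F.2.toPrimePair.I := by
      rw [← SetLike.mem_coe, ← hc]; exact hn.1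
    have hb : b ∈ F.2.toPrimePair.I := by
      rw [← SetLike.mem_coe, ← hc]; exact hn.2
    have hab := Order.Ideal.sup_mem ha hb
    rw [← SetLike.mem_coe, ← hc] at hab
    exact hab h
  · rintro (h | h)
    exacts [Order.PFilter.mem_of_le le_sup_left h, Order.PFilter.mem_of_le le_sup_right h]

theorem exists_mem_notMem {a b : A} (h : ¬ a ≤ b) : ∃ F : Dual A, a ∈ F.1 ∧ b ∉ F.1 := by
  have hd : Disjoint (Order.PFilter.principal a : Set A) (Order.Ideal.principal b : Set A) := by
    rw [Set.disjoint_left]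
    exact fun c hac hcb => h (le_trans hac hcb)
  obtain ⟨J, hJ, hbJ, haJ⟩ := DistribLattice.prime_ideal_of_disjoint_filter_ideal hd
  refine ⟨⟨hJ.toPrimePair.F, hJ.toPrimePair.F_isPrime⟩, ?_, ?_⟩
  · change a ∈ hJ.toPrimePair.F
    rw [← SetLike.mem_coe, ← hJ.toPrimePair.compl_I_eq_F]
    exact Set.disjoint_left.1 haJ (le_refl a)
  · change b ∉ hJ.toPrimePair.F
    rw [← SetLike.mem_coe, ← hJ.toPrimePair.compl_I_eq_F, Set.notMem_compl_iff]
    exact hbJ (le_refl b)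

/-- The upset of the prime filters which contain `a`. -/
def basicUp (a : A) : Up (Dual A) := ⟨basic a, fun _ _ h ha => h ha⟩

theorem mem_basicUp {a : A} {F : Dual A} : F ∈ (basicUp a).carrier ↔ a ∈ F.1 := Iff.rfl

theorem basicUp_le_iff {a b : A} : basicUp a ≤ basicUp b ↔ a ≤ b := by
  refine ⟨fun h => ?_, fun h F hF => Order.PFilter.mem_of_le h hF⟩
  by_contra hn
  obtain ⟨F, ha, hb⟩ := exists_mem_notMem hn
  exact hb (h ha)

theorem finset_inf_mem (F : Dual A) {ι : Type*} (s : Finset ι) (f : ι → A) :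
    s.inf f ∈ F.1 ↔ ∀ i ∈ s, f i ∈ F.1 := by
  classical
  induction s using Finset.induction_on with
  | empty => simp
  | insert i s _ ih => simp [Order.PFilter.inf_mem_iff, ih]

theorem finset_sup_mem (F : Dual A) {ι : Type*} (s : Finset ι) (f : ι → A) :
    s.sup f ∈ F.1 ↔ ∃ i ∈ s, f i ∈ F.1 := by
  classical
  induction s using Finset.induction_on with
  | empty => simpa using F.bot_notMem
  | insert i s _ ih => simp [sup_mem_iff, ih]

/-- For each pair `F`, `G` there is an element of `F` that lies in `G` only if `F ≤ G`. The finite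
meet over all `G` of these elements belongs exactly to the prime filters above `F`, and a finite
join of such meets represents any upset. -/
theorem basicUp_surjective [Finite (Dual A)] : Function.Surjective (basicUp (A := A)) := by
  classical
  have := Fintype.ofFinite (Dual A)
  have hsep : ∀ F G : Dual A, ∃ a ∈ F.1, a ∈ G.1 → F ≤ G := by
    intro F G
    by_contra! h
    exact (h ⊤ Order.PFilter.top_mem).2 fun a ha => (h a ha).1
  choose s hs hsG using hsep
  intro U
  refine ⟨(Finset.univ.filter (· ∈ U.carrier)).sup fun F => Finset.univ.inf (s F),
    Up.eq_of_forall fun G => ?_⟩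
  rw [mem_basicUp, finset_sup_mem]
  constructor
  · rintro ⟨F, hF, hG⟩
    rw [finset_inf_mem] at hG
    exact U.upper (hsG F G (hG G (Finset.mem_univ _))) (Finset.mem_filter.1 hF).2
  · intro hG
    refine ⟨G, by simpa using hG, ?_⟩
    rw [finset_inf_mem]
    exact fun H _ => hs G H

/-- A bi-Heyting algebra with a finite dual is the algebra of the upsets of its dual. -/
noncomputable def orderIsoUp [Finite (Dual A)] : A ≃o Up (Dual A) :=
  RelIso.ofSurjective (⟨⟨basicUp, fun _ _ h => le_antisymm (basicUp_le_iff.1 h.le)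
    (basicUp_le_iff.1 h.ge)⟩, basicUp_le_iff⟩ : A ↪o Up (Dual A)) basicUp_surjective

instance [Finite A] : Finite (Dual A) :=
  Finite.of_injective (fun F : Dual A => (F.1 : Set A))
    fun _ _ h => Subtype.ext (SetLike.coe_injective h)

/-- Every upset is some `basic a`, hence clopen, and a singleton is the difference of the two upsets
`Ici F` and `Ioi F`. -/
theorem discreteTopology [Finite (Dual A)] : DiscreteTopology (Dual A) := by
  have hb : ∀ a : A, IsClopen (basic a) := fun a =>
    ⟨⟨TopologicalSpace.isOpen_generateFrom_of_mem (.inr ⟨a, rfl⟩)⟩,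
      TopologicalSpace.isOpen_generateFrom_of_mem (.inl ⟨a, rfl⟩)⟩
  have hU : ∀ U : Up (Dual A), IsClopen U.carrier := fun U => by
    obtain ⟨a, rfl⟩ := basicUp_surjective U
    exact hb a
  rw [discreteTopology_iff_isOpen_singleton]
  intro F
  have : {F} = (Up.principal F).carrier \ Set.Ioi F := by
    ext G
    simp only [Set.mem_singleton_iff, Set.mem_sdiff, Up.mem_principal, Set.mem_Ioi]
    constructor
    · rintro rfl
      exact ⟨le_rfl, lt_irrefl _⟩
    · exact fun h => (eq_of_le_of_not_lt h.1 h.2).symm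
  rw [this]
  exact (hU _).isOpen.sdiff (hU ⟨Set.Ioi F, isUpperSet_Ioi F⟩).isClosed

end Dual

/-- The upsets of isomorphic posets. -/
def Up.congr {X : Type u} {Y : Type v} [PartialOrder X] [PartialOrder Y] (e : X ≃o Y) :
    Up X ≃o Up Y where
  toFun U := ⟨e.symm ⁻¹' U.carrier, fun _ _ h hx => U.upper (e.symm.monotone h) hx⟩
  invFun U := ⟨e ⁻¹' U.carrier, fun _ _ h hx => U.upper (e.monotone h) hx⟩
  left_inv U := Up.eq_of_forall fun x => by simp
  right_inv U := Up.eq_of_forall fun x => by simp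
  map_rel_iff' {U V} := by
    refine ⟨fun h x hx => ?_, fun h x hx => h hx⟩
    simpa using @h (e x) (by simpa using hx)

theorem IsBiPMorphism.of_orderIso {X : Type u} {Y : Type v} [PartialOrder X] [PartialOrder Y]
    (e : X ≃o Y) : IsBiPMorphism e where
  mono _ _ h := e.monotone h
  up x y h := ⟨e.symm y, by simpa [e.le_symm_apply] using h, by simp⟩
  down x y h := ⟨e.symm y, by simpa [e.symm_apply_le] using h, by simp⟩

/-- A bijective bi-p-morphism is an order isomorphism. -/
noncomputable def IsBiPMorphism.orderIso {X : Type u} {Y : Type v} [PartialOrder X]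
    [PartialOrder Y] {f : X → Y} (hf : IsBiPMorphism f) (hb : Function.Bijective f) : X ≃o Y where
  toEquiv := Equiv.ofBijective f hb
  map_rel_iff' {a b} := by
    refine ⟨fun h => ?_, hf.mono a b⟩
    obtain ⟨z, hz, hzb⟩ := hf.up a _ h
    exact hb.1 hzb ▸ hz

theorem isomorphic_dual_iff {A : Type u} [BiheytingAlgebra A] {Y : Type v} [PartialOrder Y]
    [TopologicalSpace Y] [Finite Y] : Isomorphic (Dual A) Y ↔ Nonempty (Dual A ≃o Y) := by
  constructor
  · rintro ⟨f, hb, -, hf⟩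
    exact ⟨hf.orderIso hb⟩
  · rintro ⟨e⟩
    have : Finite (Dual A) := .of_equiv Y e.symm.toEquiv
    have := Dual.discreteTopology (A := A)
    exact ⟨e, e.bijective, continuous_of_discreteTopology, .of_orderIso e⟩

/-! ### Homomorphisms of upset algebras and bi-p-morphisms -/

/-- The homomorphism dual to a bi-p-morphism. -/
def IsBiPMorphism.preimage {X : Type u} {Y : Type v} [PartialOrder X] [PartialOrder Y] {f : X → Y}
    (hf : IsBiPMorphism f) : BiheytingHom (Up Y) (Up X) where
  toFun U := ⟨f ⁻¹' U.carrier, fun _ _ h hx => U.upper (hf.mono _ _ h) hx⟩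
  map_sup' _ _ := rfl
  map_inf' _ _ := rfl
  map_himp' U V := Up.eq_of_forall fun x => by
    refine ⟨fun h y hxy hy => h _ (hf.mono _ _ hxy) hy, fun h y hxy hy => ?_⟩
    obtain ⟨z, hz, rfl⟩ := hf.up _ _ hxy
    exact h z hz hy
  map_sdiff' U V := Up.eq_of_forall fun x => by
    constructor
    · rintro ⟨y, hyx, hy⟩
      obtain ⟨z, hz, rfl⟩ := hf.down _ _ hyx
      exact ⟨z, hz, hy⟩
    · rintro ⟨y, hyx, hy⟩
      exact ⟨f y, hf.mono _ _ hyx, hy⟩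

theorem IsBiPMorphism.preimage_le_iff {X : Type u} {Y : Type v} [PartialOrder X] [PartialOrder Y]
    {f : X → Y} (hf : IsBiPMorphism f) (hs : Function.Surjective f) {U V : Up Y} :
    hf.preimage U ≤ hf.preimage V ↔ U ≤ V := by
  refine ⟨fun h y hy => ?_, fun h x hx => h hx⟩
  obtain ⟨x, rfl⟩ := hs y
  exact h hy

theorem Up.mem_finset_sup {X : Type u} [PartialOrder X] {ι : Type*} (s : Finset ι)
    (f : ι → Up X) {x : X} : x ∈ (s.sup f).carrier ↔ ∃ i ∈ s, x ∈ (f i).carrier := by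
  classical
  induction s using Finset.induction_on with
  | empty => simp
  | insert i s _ ih => simp [Up.mem_sup, ih]

theorem Up.mem_finset_inf {X : Type u} [PartialOrder X] {ι : Type*} (s : Finset ι)
    (f : ι → Up X) {x : X} : x ∈ (s.inf f).carrier ↔ ∀ i ∈ s, x ∈ (f i).carrier := by
  classical
  induction s using Finset.induction_on with
  | empty => simp
  | insert i s _ ih => simp [Up.mem_inf, ih]

/-- The upsets `U` with `x ∈ h U` form a prime filter of a finite lattice. Its least member `U₀` is
a finite join of principal upsets, and primeness makes one of them generate the filter; its base
point is the image of `x` under the dual map. -/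
theorem exists_mem_map_iff {X : Type u} {Y : Type v} [PartialOrder X] [PartialOrder Y] [Finite Y]
    (h : BiheytingHom (Up Y) (Up X)) (x : X) : ∃ y : Y, ∀ U, x ∈ (h U).carrier ↔ y ∈ U.carrier := by
  classical
  have := Fintype.ofFinite Y
  have := Fintype.ofFinite (Up Y)
  let U₀ : Up Y := (Finset.univ.filter fun U => x ∈ (h U).carrier).inf id
  have hU₀ : x ∈ (h U₀).carrier := by
    rw [map_finset_inf, Up.mem_finset_inf]
    exact fun U hU => (Finset.mem_filter.1 hU).2
  have hmin : ∀ U, x ∈ (h U).carrier → U₀ ≤ U := fun U hU =>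
    Finset.inf_le (f := id) (by simpa using hU)
  have hsup : U₀ = (Finset.univ.filter (· ∈ U₀.carrier)).sup Up.principal := by
    refine Up.eq_of_forall fun y => ?_
    rw [Up.mem_finset_sup]
    constructor
    · exact fun hy => ⟨y, by simpa using hy, le_rfl⟩
    · rintro ⟨z, hz, hzy⟩
      exact U₀.upper hzy (Finset.mem_filter.1 hz).2
  rw [hsup, map_finset_sup, Up.mem_finset_sup] at hU₀
  obtain ⟨y, hy, hxy⟩ := hU₀
  refine ⟨y, fun U => ⟨fun hU => hmin U hU (Finset.mem_filter.1 hy).2, fun hU => ?_⟩⟩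
  exact OrderHomClass.mono h (Up.principal_le.2 hU) hxy

/-- An embedding of algebras of upsets is dual to a surjective bi-p-morphism. -/
theorem exists_biPMorphism {X : Type u} {Y : Type v} [PartialOrder X] [PartialOrder Y] [Finite Y]
    (h : BiheytingHom (Up Y) (Up X)) (hle : ∀ U V, h U ≤ h V → U ≤ V) :
    ∃ f : X → Y, IsBiPMorphism f ∧ Function.Surjective f := by
  choose f hf using exists_mem_map_iff h
  -- The pair `principal y`, `V y` isolates `y`: it is the only point in the first upset and not in
  -- the second. Applying `h` to `principal y ⇨ V y` and `principal y \ V y` yields the two lifting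
  -- conditions.
  let V (y : Y) : Up Y := ⟨Set.Ioi y, isUpperSet_Ioi y⟩
  have hV : ∀ {y z : Y}, y ≤ z → z ∉ (V y).carrier → z = y :=
    fun h₁ h₂ => (eq_of_le_of_not_lt h₁ h₂).symm
  refine ⟨f, ⟨fun x z hxz => ?_, fun x y hxy => ?_, fun x y hxy => ?_⟩, fun y => ?_⟩
  · exact (hf z (Up.principal (f x))).1 ((h _).upper hxz ((hf x _).2 le_rfl))
  · by_contra! hn
    have hx : x ∈ (h (Up.principal y ⇨ V y)).carrier := by
      rw [map_himp]
      intro z hxz hz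
      by_contra hzV
      exact hn z hxz (hV ((hf z _).1 hz) fun h => hzV ((hf z _).2 h))
    exact lt_irrefl y ((hf x _).1 hx y hxy le_rfl)
  · have hx : x ∈ (h (Up.principal y \ V y)).carrier :=
      (hf x _).2 ⟨y, hxy, le_rfl, lt_irrefl y⟩
    rw [map_sdiff] at hx
    obtain ⟨z, hzx, hz, hzV⟩ := hx
    exact ⟨z, hzx, hV ((hf z _).1 hz) fun h => hzV ((hf z _).2 h)⟩
  · have hn : ¬ h (Up.principal y) ≤ h (V y) :=
      fun hn => lt_irrefl y (hle _ _ hn (le_refl y))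
    simp only [Up.le_iff, not_forall] at hn
    obtain ⟨z, hz, hzV⟩ := hn
    exact ⟨z, hV ((hf z _).1 hz) fun h => hzV ((hf z _).2 h)⟩

/-! ### Refutation of Jankov and subframe formulas -/

theorem Fm.le_eval_bigAnd {A : Type u} [BiheytingAlgebra A] {ι : Type v} [Finite ι] (f : ι → Fm)
    (w : ℕ → A) (a : A) : a ≤ (Fm.bigAnd f).eval w ↔ ∀ i, a ≤ (f i).eval w := by
  have key : ∀ l : List Fm, a ≤ (l.foldr Fm.and Fm.top).eval w ↔ ∀ φ ∈ l, a ≤ φ.eval w := by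
    intro l
    induction l with
    | nil => simp [Fm.eval]
    | cons φ l ih => simp [Fm.eval, ih]
  rw [Fm.bigAnd, key]
  simp only [List.mem_map, List.mem_finRange, true_and, forall_exists_index,
    forall_apply_eq_imp_iff]
  exact (Finite.equivFin ι).symm.forall_congr_right (q := fun i => a ≤ (f i).eval w)

theorem Fm.eval_bigAnd_eq_top {A : Type u} [BiheytingAlgebra A] {ι : Type v} [Finite ι]
    (f : ι → Fm) (w : ℕ → A) : (Fm.bigAnd f).eval w = ⊤ ↔ ∀ i, (f i).eval w = ⊤ := by
  simp only [← top_le_iff, Fm.le_eval_bigAnd]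

theorem Fm.eval_iff_eq_top {A : Type u} [BiheytingAlgebra A] (φ ψ : Fm) (w : ℕ → A) :
    (Fm.iff φ ψ).eval w = ⊤ ↔ φ.eval w = ψ.eval w := by
  simp only [Fm.iff, Fm.eval, inf_eq_top_iff, himp_eq_top_iff]
  exact le_antisymm_iff.symm

section

variable {B : Type u} [BiheytingAlgebra B] [Finite B] {A : Type v} [BiheytingAlgebra A]

theorem eval_joinCoimpDiagram_eq_top (w : ℕ → A) :
    (joinCoimpDiagram B).eval w = ⊤ ↔
      (∀ a b, (pvar B (a ⊔ b)).eval w = (pvar B a).eval w ⊔ (pvar B b).eval w) ∧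
      (∀ a b, (pvar B (a \ b)).eval w = (pvar B a).eval w \ (pvar B b).eval w) := by
  simp only [joinCoimpDiagram, Fm.eval, inf_eq_top_iff, Fm.eval_bigAnd_eq_top,
    Fm.eval_iff_eq_top, Prod.forall]

theorem eval_diagram_eq_top (w : ℕ → A) :
    (diagram B).eval w = ⊤ ↔
      ((∀ a b, (pvar B (a ⊔ b)).eval w = (pvar B a).eval w ⊔ (pvar B b).eval w) ∧
      (∀ a b, (pvar B (a \ b)).eval w = (pvar B a).eval w \ (pvar B b).eval w)) ∧
      (∀ a b, (pvar B (a ⊓ b)).eval w = (pvar B a).eval w ⊓ (pvar B b).eval w) ∧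
      (∀ a b, (pvar B (a ⇨ b)).eval w = (pvar B a).eval w ⇨ (pvar B b).eval w) ∧
      (pvar B ⊥).eval w = ⊥ ∧ (pvar B ⊤).eval w = ⊤ := by
  simp only [diagram, Fm.eval, inf_eq_top_iff, Fm.eval_bigAnd_eq_top, Fm.eval_iff_eq_top,
    Prod.forall, eval_joinCoimpDiagram_eq_top]

end

theorem exists_eval_pvar {B : Type u} [Finite B] {A : Type v} [BiheytingAlgebra A]
    (v : B → A) : ∃ w : ℕ → A, ∀ b, (pvar B b).eval w = v b := by
  -- The value `⊤` outside the range of the enumeration is arbitrary: no `pvar B b` uses those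
  -- indices.
  refine ⟨fun n => if h : n < Nat.card B then v ((Finite.equivFin B).symm ⟨n, h⟩) else ⊤,
    fun b => ?_⟩
  simp [pvar, Fm.eval]

section

variable {B : Type u} [BiheytingAlgebra B] [Finite B] {X : Type v} [PartialOrder X] {t : X}

/-- An upset is nonempty iff it contains the greatest point `t`. So the negation has value `⊤` iff
`t` is not in the separation, and `t` lies in a difference iff the corresponding inclusion fails. -/
theorem eval_separation_neg_eq_top (ht : ∀ x, x ≤ t) (w : ℕ → Up X) :
    (separation B).neg.eval w = ⊤ ↔
      ¬ ∀ a b : B, (pvar B a).eval w ≤ (pvar B b).eval w → a ≤ b := by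
  have hmem : ∀ U : Up X, t ∈ U.carrier ↔ Up.principal t ≤ U := fun U => Up.principal_le.symm
  have h₁ : (separation B).neg.eval w = ⊤ ↔ t ∉ ((separation B).eval w).carrier := by
    simp only [Fm.neg, Fm.eval, himp_eq_top_iff, le_bot_iff]
    constructor
    · intro h
      rw [h]
      exact Up.notMem_bot
    · exact fun h => Up.eq_of_forall fun x =>
        ⟨fun hx => h (((separation B).eval w).upper (ht x) hx), fun hx => hx.elim⟩
  rw [h₁, hmem, separation, Fm.le_eval_bigAnd, not_iff_not]
  simp only [← hmem, Subtype.forall, Prod.forall]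
  refine forall₂_congr fun a b => ?_
  have h₂ : t ∈ ((pvar B a).eval w \ (pvar B b).eval w).carrier ↔
      ¬ (pvar B a).eval w ≤ (pvar B b).eval w := by
    simp [Up.mem_sdiff, Up.le_iff, ht]
  change (¬ a ≤ b → t ∈ ((pvar B a).eval w \ (pvar B b).eval w).carrier) ↔ _
  rw [h₂, not_imp_not]

/-- With a greatest point, `¬∼` sends every value other than `⊤` to `⊥`. The formula thus expresses
a genuine implication between "has value `⊤`" statements. -/
theorem eval_coneg_neg_imp_eq_top (ht : ∀ x, x ≤ t) (φ ψ : Fm) (w : ℕ → Up X) :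
    (Fm.imp φ.coneg.neg ψ).eval w = ⊤ ↔ (φ.eval w = ⊤ → ψ.eval w = ⊤) := by
  simp only [Fm.eval, Fm.neg, Fm.coneg]
  by_cases h : φ.eval w = ⊤
  · simp [h]
  · simp only [h, false_imp_iff, iff_true]
    have : (⊤ \ φ.eval w) ⇨ ⊥ = (⊥ : Up X) := by
      refine Up.eq_of_forall fun x => ⟨fun hx => ?_, fun hx => hx.elim⟩
      obtain ⟨y, hy⟩ : ∃ y, y ∉ (φ.eval w).carrier := by
        by_contra! hn
        exact h (Up.eq_of_forall fun y => ⟨fun _ => trivial, fun _ => hn y⟩)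
      exact hx t (ht x) ⟨y, ht y, trivial, hy⟩
    rw [this, bot_himp]

theorem valid_algJankov_iff (ht : ∀ x, x ≤ t) :
    Valid (Up X) (algJankov B) ↔
      ¬ ∃ h : BiheytingHom B (Up X), ∀ a b, h a ≤ h b → a ≤ b := by
  constructor
  · rintro hv ⟨h, hh⟩
    obtain ⟨w, hw⟩ := exists_eval_pvar h
    have := (eval_coneg_neg_imp_eq_top ht _ _ w).1 (hv w)
    rw [eval_separation_neg_eq_top ht, eval_diagram_eq_top] at this
    simp only [hw] at this
    exact this ⟨⟨map_sup h, map_sdiff h⟩, map_inf h, map_himp h, map_bot h, map_top h⟩ hh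
  · intro hn w
    rw [algJankov, eval_coneg_neg_imp_eq_top ht, eval_separation_neg_eq_top ht,
      eval_diagram_eq_top]
    rintro ⟨⟨hsup, hsdiff⟩, hinf, hhimp, -, -⟩ hle
    -- Preservation of `⊥` and `⊤` is part of preserving the two implications, since `⊥ = a \ a` and
    -- `⊤ = a ⇨ a`.
    exact hn ⟨⟨⟨⟨fun b => (pvar B b).eval w, hsup⟩, hinf⟩, hhimp, hsdiff⟩, hle⟩

theorem valid_algSubframe_iff (ht : ∀ x, x ≤ t) :
    Valid (Up X) (algSubframe B) ↔
      ¬ ∃ h : B → Up X, (∀ a b, h (a ⊔ b) = h a ⊔ h b) ∧ (∀ a b, h (a \ b) = h a \ h b) ∧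
        ∀ a b, h a ≤ h b → a ≤ b := by
  constructor
  · rintro hv ⟨h, hsup, hsdiff, hh⟩
    obtain ⟨w, hw⟩ := exists_eval_pvar h
    have := (eval_coneg_neg_imp_eq_top ht _ _ w).1 (hv w)
    rw [eval_separation_neg_eq_top ht, eval_joinCoimpDiagram_eq_top] at this
    simp only [hw] at this
    exact this ⟨hsup, hsdiff⟩ hh
  · intro hn w
    rw [algSubframe, eval_coneg_neg_imp_eq_top ht, eval_separation_neg_eq_top ht,
      eval_joinCoimpDiagram_eq_top]
    rintro ⟨hsup, hsdiff⟩ hle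
    exact hn ⟨fun b => (pvar B b).eval w, hsup, hsdiff, hle⟩

end

theorem valid_jankov_iff {X : Type u} [PartialOrder X] {t : X} (ht : ∀ x, x ≤ t) {Y : Type v}
    [PartialOrder Y] [Finite Y] :
    Valid (Up X) (jankov Y) ↔ ¬ ∃ f : X → Y, IsBiPMorphism f ∧ Function.Surjective f := by
  rw [jankov, valid_algJankov_iff ht, not_iff_not]
  constructor
  · rintro ⟨h, hh⟩
    exact exists_biPMorphism h hh
  · rintro ⟨f, hf, hs⟩
    exact ⟨hf.preimage, fun a b => (hf.preimage_le_iff hs).1⟩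

/-- Sending `U` to the upset generated by `e '' U` preserves joins and co-implications and reflects
inclusion. Meets and implications may fail, which is why only the join and co-implication diagram
enters the subframe formula. -/
theorem not_valid_subframe {X : Type u} [PartialOrder X] {t : X} (ht : ∀ x, x ≤ t) {Y : Type v}
    [PartialOrder Y] [Finite Y] (e : Y ↪o X) : ¬ Valid (Up X) (subframe Y) := by
  rw [subframe, valid_algSubframe_iff ht, not_not]
  refine ⟨fun U => ⟨{x | ∃ y ∈ U.carrier, e y ≤ x}, fun a b h ⟨y, hy, hya⟩ => ⟨y, hy, hya.trans h⟩⟩,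
    fun U V => Up.eq_of_forall fun x => ?_, fun U V => Up.eq_of_forall fun x => ?_, ?_⟩
  · constructor
    · rintro ⟨y, hy | hy, hyx⟩
      exacts [.inl ⟨y, hy, hyx⟩, .inr ⟨y, hy, hyx⟩]
    · rintro (⟨y, hy, hyx⟩ | ⟨y, hy, hyx⟩)
      exacts [⟨y, .inl hy, hyx⟩, ⟨y, .inr hy, hyx⟩]
  · constructor
    · rintro ⟨y, ⟨z, hzy, hzU, hzV⟩, hyx⟩
      refine ⟨e z, (e.monotone hzy).trans hyx, ⟨z, hzU, le_rfl⟩, ?_⟩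
      rintro ⟨y', hy', hle⟩
      exact hzV (V.upper (e.le_iff_le.1 hle) hy')
    · rintro ⟨z, hzx, ⟨y, hyU, hyz⟩, hzV⟩
      exact ⟨y, ⟨y, le_rfl, hyU, fun h => hzV ⟨y, h, hyz⟩⟩, hyz.trans hzx⟩
  · intro U V h y hy
    obtain ⟨y', hy', hle⟩ := h ⟨y, hy, le_rfl⟩
    exact V.upper (e.le_iff_le.1 hle) hy'

/-! ### Combs validate the axioms -/

instance : DecidableLE F0 := fun x y =>
  inferInstanceAs (Decidable (x = y ∨ y = .a ∨ (x = .d ∧ y = .b) ∨ (x = .e ∧ y = .c)))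
instance : DecidableLE F1 := fun x y =>
  inferInstanceAs (Decidable (x = y ∨ y = .a ∨ (x = .c ∧ y = .b)))
instance : DecidableLE F2 := fun x y =>
  inferInstanceAs (Decidable (x = y ∨ y = .a ∨ (x = .d ∧ y = .c) ∨ (x = .d ∧ y = .b) ∨
    (x = .c ∧ y = .b)))
instance : DecidableLE F3 := fun x y => inferInstanceAs (Decidable (x = y ∨ y = .a))
instance : DecidableLT F0 := decidableLTOfDecidableLE
instance : DecidableLT F1 := decidableLTOfDecidableLE
instance : DecidableLT F2 := decidableLTOfDecidableLE

/-- Above a point `x`, a failure of the axiom is a pair of incomparable points; conversely two such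
points refute it through their principal upsets. -/
theorem inVariety_biGD_up_iff {X : Type u} [PartialOrder X] :
    InVariety biGD (Up X) ↔ ∀ x y z : X, x ≤ y → x ≤ z → y ≤ z ∨ z ≤ y := by
  rw [inVariety_biGD_iff]
  constructor
  · intro h x y z hxy hxz
    have hx : x ∈ ((Up.principal y ⇨ Up.principal z) ⊔ (Up.principal z ⇨ Up.principal y)).carrier :=
      by rw [h]; trivial
    rcases hx with hx | hx
    exacts [.inr (hx y hxy le_rfl), .inl (hx z hxz le_rfl)]
  · intro h U V
    refine Up.eq_of_forall fun x => ⟨fun _ => trivial, fun _ => ?_⟩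
    by_contra hn
    simp only [Up.mem_sup, Up.mem_himp, not_or, not_forall] at hn
    obtain ⟨⟨y, hxy, hyU, hyV⟩, z, hxz, hzV, hzU⟩ := hn
    rcases h x y z hxy hxz with h | h
    exacts [hzU (U.upper h hyU), hyV (V.upper h hzV)]

theorem IsBiPMorphism.isMin {X : Type u} {Y : Type v} [PartialOrder X] [PartialOrder Y] {f : X → Y}
    (hf : IsBiPMorphism f) {x : X} (hx : IsMin x) : IsMin (f x) := by
  intro y hy
  obtain ⟨z, hz, rfl⟩ := hf.down x y hy
  rw [le_antisymm hz (hx hz)]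

namespace Comb

variable {n : ℕ}

@[simp] theorem spine_le_spine {i j : Fin n} : spine i ≤ spine j ↔ i ≤ j := Iff.rfl
@[simp] theorem tooth_le_spine {i j : Fin n} : tooth i ≤ spine j ↔ i ≤ j := Iff.rfl
@[simp] theorem tooth_le_tooth {i j : Fin n} : tooth i ≤ tooth j ↔ i = j := Iff.rfl
@[simp] theorem not_spine_le_tooth {i j : Fin n} : ¬ spine i ≤ tooth j := id

instance : Finite (Comb n) :=
  Finite.of_surjective (Sum.elim spine tooth) fun x => by
    cases x with
    | spine i => exact ⟨.inl i, rfl⟩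
    | tooth i => exact ⟨.inr i, rfl⟩

theorem exists_greatest (hn : 0 < n) : ∃ t : Comb n, ∀ x, x ≤ t := by
  refine ⟨spine ⟨n - 1, by omega⟩, fun x => ?_⟩
  cases x <;> simp [Fin.le_def] <;> omega

theorem isMin_tooth (i : Fin n) : IsMin (tooth i) := by
  intro y hy
  cases y <;> simp_all

theorem le_total_of_le {x y z : Comb n} (hy : x ≤ y) (hz : x ≤ z) : y ≤ z ∨ z ≤ y := by
  cases x <;> cases y <;> cases z <;> simp_all <;> exact le_total _ _

/-- The map `h` preserves too little to come from a map of posets, so the argument runs in the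
algebra. Each branch of `F0` is shown to force a spine point that lies in the image of its own
leaf's upset but not in that of the other leaf. Two spine points are comparable, and upward closure
gives a contradiction. -/
theorem valid_subframe_F0 (hn : 0 < n) : Valid (Up (Comb n)) (subframe F0) := by
  obtain ⟨t, ht⟩ := exists_greatest hn
  rw [subframe, valid_algSubframe_iff ht]
  rintro ⟨h, hsup, hsdiff, hle⟩
  have hmono : ∀ U V, U ≤ V → h U ≤ h V := fun U V hUV => by
    rw [← sup_eq_right.2 hUV, hsup]
    exact le_sup_left
  have key : ∀ y x z : F0, x < y → ¬ z ≤ y → ∃ i : Fin n, ∃ p : Comb n, p ≤ spine i ∧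
      p ∈ (h (Up.principal x)).carrier ∧ spine i ∉ (h (Up.principal z)).carrier := by
    intro y x z hxy hzy
    have h₁ : ¬ h (Up.principal y) ≤ h (Up.principal z) := fun hh => hzy (hle _ _ hh (le_refl y))
    simp only [Up.le_iff, not_forall] at h₁
    obtain ⟨q, hqb, hqe⟩ := h₁
    -- Since `x` lies strictly below `y`, this identity holds, and applying `h` puts below `q` a
    -- point `p` outside `h (Up.principal y)`. As `q` belongs to that upset, `p ≠ q`, so `q` is not
    -- minimal and must lie on the spine.
    have h₂ : Up.principal x \ Up.principal y = Up.principal x := by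
      refine Up.eq_of_forall fun u => ⟨?_, fun hu => ⟨x, hu, le_refl x, hxy.not_ge⟩⟩
      rintro ⟨u', hu', hxu', -⟩
      exact hxu'.trans hu'
    have hqd : q ∈ (h (Up.principal x)).carrier := hmono _ _ (Up.principal_le.2 hxy.le) hqb
    rw [← h₂, hsdiff] at hqd
    obtain ⟨p, hpq, hpd, hpb⟩ := hqd
    cases q with
    | spine i => exact ⟨i, p, hpq, hpd, hqe⟩
    | tooth i =>
      have : p = tooth i := le_antisymm hpq (isMin_tooth i hpq)
      exact (hpb (this ▸ hqb)).elim
  obtain ⟨i, p, hpi, hpd, hie⟩ := key .b .d .e (by decide) (by decide)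
  obtain ⟨j, q, hqj, hqe, hjd⟩ := key .c .e .d (by decide) (by decide)
  rcases le_total i j with hij | hij
  · exact hjd ((h _).upper (hpi.trans hij) hpd)
  · exact hie ((h _).upper (hqj.trans hij) hqe)

/-- A tooth of a comb survives in every image: `y` is the image of some `x_i`, and `m` is the image
of the tooth `x_i'`. Anything strictly above `m` is the image of a spine point above `x_i`. The
points `a` of `F1` and `b` of `F2` violate this property. -/
theorem exists_isMin_of_biPMorphism {Y : Type v} [PartialOrder Y] {f : Comb n → Y}
    (hf : IsBiPMorphism f) (hs : Function.Surjective f) {y : Y} (hy : ¬ IsMin y) :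
    ∃ m, IsMin m ∧ m < y ∧ ∀ w, m < w → y ≤ w := by
  obtain ⟨z, rfl⟩ := hs y
  cases z with
  | tooth i => exact (hy (hf.isMin (isMin_tooth i))).elim
  | spine i =>
    have hm := hf.isMin (isMin_tooth i)
    have hle : f (tooth i) ≤ f (spine i) := hf.mono _ _ (tooth_le_spine.2 le_rfl)
    refine ⟨f (tooth i), hm, hle.lt_of_ne fun h => hy (h ▸ hm), fun w hw => ?_⟩
    obtain ⟨u, hu, rfl⟩ := hf.up _ _ hw.le
    cases u with
    | spine j => exact hf.mono _ _ hu
    | tooth j =>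
      cases tooth_le_tooth.1 hu
      exact (lt_irrefl _ hw).elim

theorem valid_jankov_F1 (hn : 0 < n) : Valid (Up (Comb n)) (jankov F1) := by
  obtain ⟨t, ht⟩ := exists_greatest hn
  rw [valid_jankov_iff ht]
  rintro ⟨f, hf, hs⟩
  obtain ⟨m, hm, hma, hmw⟩ := exists_isMin_of_biPMorphism hf hs (y := .a) (by unfold IsMin; decide)
  revert m
  unfold IsMin
  decide

theorem valid_jankov_F2 (hn : 0 < n) : Valid (Up (Comb n)) (jankov F2) := by
  obtain ⟨t, ht⟩ := exists_greatest hn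
  rw [valid_jankov_iff ht]
  rintro ⟨f, hf, hs⟩
  obtain ⟨m, hm, hma, hmw⟩ := exists_isMin_of_biPMorphism hf hs (y := .b) (by unfold IsMin; decide)
  revert m
  unfold IsMin
  decide

/-- Let `x_i` be the lowest spine point sent to `a`. The spine point just below it goes to a leaf,
so everything under that point collapses to one leaf `v`. Hence `↓x_i` has at most the three values
`a`, `v` and the image of the tooth `x_i'`, whereas the lifting condition demands all four. -/
theorem valid_jankov_F3 (hn : 0 < n) : Valid (Up (Comb n)) (jankov F3) := by
  obtain ⟨t, ht⟩ := exists_greatest hn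
  rw [valid_jankov_iff ht]
  rintro ⟨f, hf, hs⟩
  have hleaf : ∀ y : F3, y ≠ .a → IsMin y := by unfold IsMin; decide
  have hex : ∃ i, f (spine i) = .a := by
    obtain ⟨z, hz⟩ := hs .a
    cases z with
    | spine i => exact ⟨i, hz⟩
    | tooth i =>
      have := hf.isMin (isMin_tooth i)
      rw [hz] at this
      exact absurd (this (b := .b) (by decide)) (by decide)
  obtain ⟨i, hi, hmin⟩ : ∃ i, f (spine i) = .a ∧ ∀ j, f (spine j) = .a → i ≤ j := by
    obtain ⟨i, hi⟩ := (Set.toFinite {i | f (spine i) = .a}).exists_minimal hex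
    exact ⟨i, hi.1, fun j hj => (le_total i j).elim id fun h => hi.2 hj h⟩
  obtain ⟨v, hv⟩ : ∃ v, ∀ j, j < i → f (spine j) = v ∧ f (tooth j) = v := by
    by_cases h0 : (i : ℕ) = 0
    -- At the bottom of the spine there is no `j < i`, so any value serves as `v`.
    · exact ⟨.a, fun j hj => by have := Fin.lt_def.1 hj; omega⟩
    · let k : Fin n := ⟨i - 1, by omega⟩
      have hk : IsMin (f (spine k)) := hleaf _ fun h => by
        have := Fin.le_def.1 (hmin k h)
        simp only [k] at this
        omega
      have hle : ∀ j, j < i → j ≤ k := fun j hj => by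
        have := Fin.lt_def.1 hj
        rw [Fin.le_def]
        simp only [k]
        omega
      have hx : ∀ x, x ≤ spine k → f x = f (spine k) := fun x hx =>
        le_antisymm (hf.mono _ _ hx) (hk (hf.mono _ _ hx))
      exact ⟨f (spine k), fun j hj => ⟨hx _ (hle j hj), hx _ (hle j hj)⟩⟩
  have hval : ∀ y : F3, y = .a ∨ y = v ∨ y = f (tooth i) := by
    intro y
    obtain ⟨z, hz, rfl⟩ := hf.down (spine i) y (by rw [hi]; revert y; decide)
    cases z with
    | spine j =>
      rcases (spine_le_spine.1 hz).eq_or_lt with rfl | hj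
      exacts [.inl hi, .inr (.inl (hv j hj).1)]
    | tooth j =>
      rcases (tooth_le_spine.1 hz).eq_or_lt with rfl | hj
      exacts [.inr (.inr rfl), .inr (.inl (hv j hj).2)]
  have hb := hval .b
  have hc := hval .c
  have hd := hval .d
  grind

theorem inVariety_LFC (hn : 0 < n) : InVariety LFC (Up (Comb n)) := by
  refine inVariety_extend_iff.2 ⟨inVariety_biGD_up_iff.2 fun x y z => le_total_of_le, ?_⟩
  rintro φ (rfl | rfl | rfl | rfl)
  exacts [valid_subframe_F0 hn, valid_jankov_F1 hn, valid_jankov_F2 hn, valid_jankov_F3 hn]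

end Comb

theorem LFC_subset_LogFC : LFC ⊆ LogFC := fun φ hφ _ hn => Comb.inVariety_LFC hn φ hφ

/-! ### Hcombs as images of combs -/

namespace HComb

variable {n : ℕ}

@[simp] theorem spine_le_spine {i j : Fin (n + 1)} : spine (n := n) i ≤ spine j ↔ i ≤ j := Iff.rfl
@[simp] theorem tooth_le_spine {i : Fin n} {j : Fin (n + 1)} : tooth i ≤ spine j ↔ i.succ ≤ j :=
  Iff.rfl
@[simp] theorem tooth_le_tooth {i j : Fin n} : tooth i ≤ tooth j ↔ i = j := Iff.rfl
@[simp] theorem not_spine_le_tooth {i : Fin (n + 1)} {j : Fin n} : ¬ spine i ≤ tooth j := id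

instance : Finite (HComb n) :=
  Finite.of_surjective (Sum.elim spine tooth) fun x => by
    cases x with
    | spine i => exact ⟨.inl i, rfl⟩
    | tooth i => exact ⟨.inr i, rfl⟩

theorem le_spine_last (x : HComb n) : x ≤ spine (Fin.last n) := by
  cases x <;> simp [Fin.le_last]

/-- The map from a comb onto an hcomb which identifies the two lowest points. -/
def ofComb : Comb (n + 1) → HComb n
  | .spine i => spine i
  | .tooth i => Fin.cases (spine 0) tooth i

theorem isBiPMorphism_ofComb : IsBiPMorphism (ofComb (n := n)) where
  mono x z h := by
    cases x with
    | spine i => cases z with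
      | spine j => exact h
      | tooth j => exact (Comb.not_spine_le_tooth h).elim
    | tooth i => cases z with
      | spine j => cases i using Fin.cases with
        | zero => exact Fin.zero_le j
        | succ i => exact h
      | tooth j => rw [Comb.tooth_le_tooth.1 h]
  up x y h := by
    cases x with
    | spine i => cases y with
      | spine j => exact ⟨.spine j, h, rfl⟩
      | tooth j => exact (not_spine_le_tooth h).elim
    | tooth i => cases i using Fin.cases with
      | zero => cases y with
        | spine j => exact ⟨.spine j, Fin.zero_le j, rfl⟩
        | tooth j => exact (not_spine_le_tooth h).elim
      | succ i => cases y with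
        | spine j => exact ⟨.spine j, h, rfl⟩
        | tooth j => exact ⟨.tooth i.succ, le_rfl, by rw [← tooth_le_tooth.1 h]; rfl⟩
  down x y h := by
    cases x with
    | spine i => cases y with
      | spine j => exact ⟨.spine j, h, rfl⟩
      | tooth j => exact ⟨.tooth j.succ, h, rfl⟩
    | tooth i => cases i using Fin.cases with
      | zero => cases y with
        | spine j => exact ⟨.tooth 0, le_rfl, by rw [Fin.le_zero_iff.1 (spine_le_spine.1 h)]; rfl⟩
        | tooth j => exact (Fin.succ_ne_zero j (Fin.le_zero_iff.1 (tooth_le_spine.1 h))).elim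
      | succ i => cases y with
        | spine j => exact (not_spine_le_tooth h).elim
        | tooth j => exact ⟨.tooth i.succ, le_rfl, by rw [tooth_le_tooth.1 h]; rfl⟩

theorem ofComb_surjective : Function.Surjective (ofComb (n := n)) := by
  intro y
  cases y with
  | spine j => exact ⟨.spine j, rfl⟩
  | tooth j => exact ⟨.tooth j.succ, rfl⟩

end HComb

theorem inFinSI_LogFC_comb {n : ℕ} (hn : 0 < n) : InFinSI LogFC (Up (Comb n)) := by
  obtain ⟨t, ht⟩ := Comb.exists_greatest hn
  exact ⟨fun φ hφ => hφ n hn, isSI_up_of_greatest ht, inferInstance⟩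

theorem inFinSI_LogFC_hcomb (n : ℕ) : InFinSI LogFC (Up (HComb n)) := by
  refine ⟨fun φ hφ => ?_, isSI_up_of_greatest HComb.le_spine_last, inferInstance⟩
  refine (hφ (n + 1) n.succ_pos).of_injective HComb.isBiPMorphism_ofComb.preimage fun U V h => ?_
  exact le_antisymm
    ((HComb.isBiPMorphism_ofComb.preimage_le_iff HComb.ofComb_surjective).1 h.le)
    ((HComb.isBiPMorphism_ofComb.preimage_le_iff HComb.ofComb_surjective).1 h.ge)

/-! ### Finite co-trees without the forbidden images -/

section Cotree

variable {X : Type u} [PartialOrder X] {t : X}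

/-- An element with three lower covers yields a surjection onto the three-fork. -/
theorem exists_biPMorphism_F3 (ht : ∀ x, x ≤ t)
    (hX : ∀ x y z : X, x ≤ y → x ≤ z → y ≤ z ∨ z ≤ y) {x p q r : X} (hp : p ⋖ x) (hq : q ⋖ x)
    (hr : r ⋖ x) (hpq : p ≠ q) (hpr : p ≠ r) (hqr : q ≠ r) :
    ∃ f : X → F3, IsBiPMorphism f ∧ Function.Surjective f := by
  classical
  have hinc : ∀ {p q : X}, p ⋖ x → q ⋖ x → p ≠ q → ¬ p ≤ q := fun hp hq hne hle =>
    hp.2 (hle.lt_of_ne hne) hq.lt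
  -- The set `↑x` collapses to the root, `↓p` and `↓q` to two leaves, and everything else, including
  -- branches that do not lie below `x`, to the third leaf.
  let f : X → F3 := fun z => if x ≤ z then .a else if z ≤ p then .b else if z ≤ q then .c else .d
  have fa : ∀ z, x ≤ z → f z = .a := fun z hz => if_pos hz
  have hfa : ∀ z, f z = .a → x ≤ z := fun z hz => by
    by_contra hn
    simp only [f, if_neg hn] at hz
    split_ifs at hz
  have fp : f p = .b := by simp [f, hp.lt.not_ge]
  have fq : f q = .c := by simp [f, hq.lt.not_ge, hinc hq hp hpq.symm]
  have fr : f r = .d := by simp [f, hr.lt.not_ge, hinc hr hp hpr.symm, hinc hr hq hqr.symm]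
  have hmono : ∀ z w, z ≤ w → f z ≤ f w := by
    intro z w hzw
    by_cases hw : x ≤ w
    · rw [fa w hw]
      exact (by decide : ∀ y : F3, y ≤ .a) _
    · have hz : ¬ x ≤ z := fun h => hw (h.trans hzw)
      -- Outside `↑x`, the set `↓p` under a lower cover `p` of `x` is also closed upwards, by the
      -- chain condition. Comparable points outside `↑x` therefore receive the same leaf.
      have hcov : ∀ {p : X}, p ⋖ x → z ≤ p → w ≤ p := by
        intro p hp hzp
        rcases hX z w p hzw hzp with h | h
        · exact h
        · rcases hX p w x h hp.le with h' | h'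
          · rcases h.eq_or_lt with rfl | h
            · exact le_rfl
            · exact (hp.2 h (h'.lt_of_not_ge hw)).elim
          · exact (hw h').elim
      have e₁ : z ≤ p ↔ w ≤ p := ⟨hcov hp, hzw.trans⟩
      have e₂ : z ≤ q ↔ w ≤ q := ⟨hcov hq, hzw.trans⟩
      simp only [f, if_neg hw, if_neg hz, e₁, e₂, le_refl]
  have hdown : ∀ z, x ≤ z → ∀ y : F3, ∃ w, w ≤ z ∧ f w = y := by
    intro z hz y
    cases y
    exacts [⟨z, le_rfl, fa z hz⟩, ⟨p, hp.le.trans hz, fp⟩, ⟨q, hq.le.trans hz, fq⟩,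
      ⟨r, hr.le.trans hz, fr⟩]
  refine ⟨f, ⟨hmono, fun z y h => ?_, fun z y h => ?_⟩, fun y => ?_⟩
  · rcases h with rfl | rfl
    exacts [⟨z, le_rfl, rfl⟩, ⟨t, ht z, fa t (ht x)⟩]
  · rcases h with rfl | h
    exacts [⟨z, le_rfl, rfl⟩, hdown z (hfa z h) y]
  · obtain ⟨w, -, hw⟩ := hdown x le_rfl y
    exact ⟨w, hw⟩

/-- If the greatest element has a unique lower cover, which is not minimal, there is a surjection
onto the three-element chain. -/
theorem exists_biPMorphism_F1 (ht : ∀ x, x ≤ t) {p c : X} (hp : p < t)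
    (hlt : ∀ z, z < t → z ≤ p) (hc : c < p) :
    ∃ f : X → F1, IsBiPMorphism f ∧ Function.Surjective f := by
  classical
  let f : X → F1 := fun z => if z = t then .a else if z = p then .b else .c
  have ft : f t = .a := if_pos rfl
  have fp : f p = .b := by simp [f, hp.ne]
  have fc : ∀ z, z < p → f z = .c := fun z hz => by simp [f, (hz.trans hp).ne, hz.ne]
  have hcases : ∀ z, z = t ∨ z = p ∨ z < p := fun z =>
    (ht z).eq_or_lt.imp_right fun h => (hlt z h).eq_or_lt
  refine ⟨f, ⟨fun z w hzw => ?_, fun z y h => ?_, fun z y h => ?_⟩, fun y => ?_⟩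
  · rcases hcases w with rfl | rfl | hw
    · rw [ft]
      exact .inr (.inl rfl)
    · rcases hzw.eq_or_lt with rfl | hz
      · exact le_rfl
      · rw [fp, fc z hz]
        decide
    · rw [fc w hw, fc z (hzw.trans_lt hw)]
  · rcases hcases z with rfl | rfl | hz
    · rw [ft] at h
      cases y
      exacts [⟨z, le_rfl, ft⟩, absurd h (by decide), absurd h (by decide)]
    · rw [fp] at h
      cases y
      exacts [⟨t, ht z, ft⟩, ⟨z, le_rfl, fp⟩, absurd h (by decide)]
    · cases y
      exacts [⟨t, ht z, ft⟩, ⟨p, hz.le, fp⟩, ⟨z, le_rfl, fc z hz⟩]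
  · rcases hcases z with rfl | rfl | hz
    · cases y
      exacts [⟨z, le_rfl, ft⟩, ⟨p, ht p, fp⟩, ⟨c, ht c, fc c hc⟩]
    · rw [fp] at h
      cases y
      exacts [absurd h (by decide), ⟨z, le_rfl, fp⟩, ⟨c, hc.le, fc c hc⟩]
    · rw [fc z hz] at h
      cases y
      exacts [absurd h (by decide), absurd h (by decide), ⟨z, le_rfl, fc z hz⟩]
  · cases y
    exacts [⟨t, ft⟩, ⟨p, fp⟩, ⟨c, fc c hc⟩]

/-- A minimal lower cover of `y`, together with a chain `p < x < y` where `x` is a lower cover of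
`y` and `p` is the unique lower cover of `x`, yields a surjection onto `F2`. -/
theorem exists_biPMorphism_F2 (ht : ∀ x, x ≤ t)
    (hX : ∀ x y z : X, x ≤ y → x ≤ z → y ≤ z ∨ z ≤ y)
    (hN : ∀ x y : X, ¬ IsMin x → ¬ IsMin y → x ≤ y ∨ y ≤ x)
    {x y p m c : X} (hp : p < x) (hlt : ∀ z, z < x → z ≤ p) (hc : c < p) (hxy : x ⋖ y)
    (hm : IsMin m) (hmy : m ⋖ y) :
    ∃ f : X → F2, IsBiPMorphism f ∧ Function.Surjective f := by
  classical
  -- The set `↑y` goes to the root, the chain `x`, `p`, `↓p \ {p}` to the long branch, and all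
  -- remaining points to the short leaf `a'`.
  let f : X → F2 := fun z => if y ≤ z then .a else if z = x then .b else if z = p then .c else
    if z < p then .d else .a'
  have hxm : ¬ IsMin x := fun h => hp.not_ge (h hp.le)
  have fa : ∀ z, y ≤ z → f z = .a := fun z hz => if_pos hz
  have fx : f x = .b := by simp [f, hxy.lt.not_ge]
  have fp : f p = .c := by simp [f, (hp.trans hxy.lt).not_ge, hp.ne]
  have fd : ∀ z, z < p → f z = .d := fun z hz => by
    simp [f, ((hz.trans hp).trans hxy.lt).not_ge, hz, hz.ne, (hz.trans hp).ne]
  have fa' : ∀ z, ¬ y ≤ z → ¬ z ≤ x → f z = .a' := fun z h₁ h₂ => by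
    have hx : z ≠ x := fun h => h₂ h.le
    have hp' : z ≠ p := fun h => h₂ (h.le.trans hp.le)
    have hd : ¬ z < p := fun h => h₂ (h.le.trans hp.le)
    simp [f, h₁, hx, hp', hd]
  -- The points sent to `a'` are all minimal: a non-minimal one would be comparable with `x`, hence
  -- strictly above it, and then strictly between `x` and its cover `y`.
  have hmin : ∀ z, ¬ y ≤ z → ¬ z ≤ x → IsMin z := fun z h₁ h₂ => by
    by_contra h
    rcases hN z x h hxm with h | h
    · exact h₂ h
    · rcases hX x y z hxy.le h with h' | h'
      · exact h₁ h'
      · exact hxy.2 (h.lt_of_not_ge h₂) (h'.lt_of_not_ge h₁)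
  have hmx : ¬ m ≤ x := fun h => hmy.2 (h.lt_of_ne fun e => hxm (e ▸ hm)) hxy.lt
  have fm : f m = .a' := fa' m hmy.lt.not_ge hmx
  have hcases : ∀ z, y ≤ z ∨ z = x ∨ z = p ∨ z < p ∨ ¬ y ≤ z ∧ ¬ z ≤ x := fun z => by
    by_cases h₁ : y ≤ z
    · exact .inl h₁
    · by_cases h₂ : z ≤ x
      · rcases h₂.eq_or_lt with h | h
        · exact .inr (.inl h)
        · rcases (hlt z h).eq_or_lt with h | h
          exacts [.inr (.inr (.inl h)), .inr (.inr (.inr (.inl h)))]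
      · exact .inr (.inr (.inr (.inr ⟨h₁, h₂⟩)))
  have hdown : ∀ z, y ≤ z → ∀ v : F2, ∃ w, w ≤ z ∧ f w = v := by
    intro z hz v
    cases v
    exacts [⟨z, le_rfl, fa z hz⟩, ⟨m, hmy.le.trans hz, fm⟩, ⟨x, hxy.le.trans hz, fx⟩,
      ⟨p, (hp.le.trans hxy.le).trans hz, fp⟩, ⟨c, ((hc.trans hp).le.trans hxy.le).trans hz, fd c hc⟩]
  have ft : f t = .a := fa t (ht y)
  refine ⟨f, ⟨fun z w hzw => ?_, fun z v h => ?_, fun z v h => ?_⟩, fun v => ?_⟩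
  · rcases hcases w with hw | rfl | rfl | hw | ⟨h₁, h₂⟩
    · rw [fa w hw]
      exact .inr (.inl rfl)
    · rcases hzw.eq_or_lt with rfl | hz
      · exact le_rfl
      · rcases (hlt z hz).eq_or_lt with rfl | hz
        · rw [fp, fx]
          decide
        · rw [fd z hz, fx]
          decide
    · rcases hzw.eq_or_lt with rfl | hz
      · exact le_rfl
      · rw [fd z hz, fp]
        decide
    · rw [fd w hw, fd z (hzw.trans_lt hw)]
    · rw [le_antisymm hzw (hmin w h₁ h₂ hzw)]
  · by_cases hv : v = f z
    · exact ⟨z, le_rfl, hv.symm⟩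
    by_cases hva : v = .a
    · exact ⟨t, ht z, by rw [hva, ft]⟩
    rcases hcases z with hz | rfl | rfl | hz | ⟨h₁, h₂⟩
    · rw [fa z hz] at h hv
      exfalso; revert v; decide
    · rw [fx] at h hv
      exfalso; revert v; decide
    · refine ⟨x, hp.le, ?_⟩
      rw [fp] at h hv
      rw [fx]
      revert v; decide
    · rw [fd z hz] at h hv
      have : v = .c ∨ v = .b := by revert v; decide
      rcases this with rfl | rfl
      exacts [⟨p, hz.le, fp⟩, ⟨x, (hz.trans hp).le, fx⟩]
    · rw [fa' z h₁ h₂] at h hv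
      exfalso; revert v; decide
  · by_cases hv : v = f z
    · exact ⟨z, le_rfl, hv.symm⟩
    rcases hcases z with hz | rfl | rfl | hz | ⟨h₁, h₂⟩
    · exact hdown z hz v
    · rw [fx] at h hv
      have : v = .c ∨ v = .d := by revert v; decide
      rcases this with rfl | rfl
      exacts [⟨p, hp.le, fp⟩, ⟨c, (hc.trans hp).le, fd c hc⟩]
    · refine ⟨c, hc.le, ?_⟩
      rw [fp] at h hv
      rw [fd c hc]
      revert v; decide
    · rw [fd z hz] at h hv
      exfalso; revert v; decide
    · rw [fa' z h₁ h₂] at h hv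
      exfalso; revert v; decide
  · obtain ⟨w, -, hw⟩ := hdown y le_rfl v
    exact ⟨w, hw⟩

theorem nonempty_orderIso_of_surjective {Y : Type v} [PartialOrder Y] (g : Y → X)
    (hs : Function.Surjective g) (hle : ∀ a b, g a ≤ g b ↔ a ≤ b) : Nonempty (X ≃o Y) :=
  ⟨(RelIso.ofSurjective (⟨⟨g, fun a b h => le_antisymm ((hle a b).1 h.le) ((hle b a).1 h.ge)⟩,
    hle _ _⟩ : Y ↪o X) hs).symm⟩

/-- Two incomparable non-minimal points, a point strictly below each, and `t` form a copy of `F0`: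
by the chain condition a point below both would make them comparable. -/
theorem not_isMin_comparable (ht : ∀ x, x ≤ t)
    (hX : ∀ x y z : X, x ≤ y → x ≤ z → y ≤ z ∨ z ≤ y) (h0 : Valid (Up X) (subframe F0)) (x y : X)
    (hx : ¬ IsMin x) (hy : ¬ IsMin y) : x ≤ y ∨ y ≤ x := by
  by_contra! hn
  obtain ⟨hxy, hyx⟩ := hn
  obtain ⟨p, hp⟩ := not_isMin_iff.1 hx
  obtain ⟨q, hq⟩ := not_isMin_iff.1 hy
  have hpy : ¬ p ≤ y := fun h => (hX p x y hp.le h).elim hxy hyx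
  have hqx : ¬ q ≤ x := fun h => (hX q y x hq.le h).elim hyx hxy
  have hxt : ¬ t ≤ x := fun h => hyx ((ht y).trans h)
  have hyt : ¬ t ≤ y := fun h => hxy ((ht x).trans h)
  let g : F0 → X
    | .a => t
    | .b => x
    | .c => y
    | .d => p
    | .e => q
  have hg : ∀ u v, g u ≤ g v ↔ u ≤ v := by
    intro u v
    cases u <;> cases v <;> simp only [g]
    all_goals
      first
        | exact iff_of_true (ht _) (by decide)
        | exact iff_of_true le_rfl (by decide)
        | exact iff_of_true hp.le (by decide)
        | exact iff_of_true hq.le (by decide)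
        | refine iff_of_false (fun h => ?_) (by decide)
    all_goals
      first
        | exact hxt h
        | exact hyt h
        | exact hxy h
        | exact hyx h
        | exact hpy h
        | exact hqx h
        | exact hxt (h.trans hp.le)
        | exact hyt (h.trans hq.le)
        | exact hp.not_ge h
        | exact hq.not_ge h
        | exact hpy (h.trans hq.le)
        | exact hqx (h.trans hp.le)
        | exact hxy (h.trans hq.le)
        | exact hyx (h.trans hp.le)
  exact not_valid_subframe ht (⟨⟨g, fun u v h => le_antisymm ((hg u v).1 h.le) ((hg v u).1 h.ge)⟩,
    hg _ _⟩ : F0 ↪o X) h0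

/-! ### Recognising combs and hcombs -/

variable [Finite X]

theorem exists_covBy_of_lt {a b : X} (h : a < b) : ∃ c, a ≤ c ∧ c ⋖ b := by
  obtain ⟨c, hc⟩ := (Set.toFinite (Set.Ico a b)).exists_maximal ⟨a, le_rfl, h⟩
  exact ⟨c, hc.1.1, hc.1.2, fun d hcd hdb =>
    hcd.not_ge (hc.2 ⟨hc.1.1.trans hcd.le, hdb⟩ hcd.le)⟩

theorem exists_covBy_of_lt' {a b : X} (h : a < b) : ∃ c, a ⋖ c ∧ c ≤ b := by
  obtain ⟨c, hc⟩ := (Set.toFinite (Set.Ioc a b)).exists_minimal ⟨b, h, le_rfl⟩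
  exact ⟨c, ⟨hc.1.1, fun d had hdc =>
    hdc.not_ge (hc.2 ⟨had, hdc.le.trans hc.1.2⟩ hdc.le)⟩, hc.1.2⟩

/-- Every element which is not minimal has a minimal lower cover. -/
theorem exists_isMin_covBy (ht : ∀ x, x ≤ t)
    (hX : ∀ x y z : X, x ≤ y → x ≤ z → y ≤ z ∨ z ≤ y)
    (hN : ∀ x y : X, ¬ IsMin x → ¬ IsMin y → x ≤ y ∨ y ≤ x)
    (h1 : ¬ ∃ f : X → F1, IsBiPMorphism f ∧ Function.Surjective f)
    (h2 : ¬ ∃ f : X → F2, IsBiPMorphism f ∧ Function.Surjective f) (x : X) (hx : ¬ IsMin x) :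
    ∃ m, IsMin m ∧ m ⋖ x := by
  by_contra hbad
  -- A maximal counterexample is taken so that any upper cover of it does have a minimal lower
  -- cover, as the map onto `F2` requires.
  obtain ⟨x, ⟨hx, hbad⟩, hmax⟩ :=
    (Set.toFinite {x : X | ¬ IsMin x ∧ ¬ ∃ m, IsMin m ∧ m ⋖ x}).exists_maximal ⟨x, hx, hbad⟩
  obtain ⟨q, hq⟩ := not_isMin_iff.1 hx
  obtain ⟨p, -, hp⟩ := exists_covBy_of_lt hq
  have hpmin : ∀ q, q ⋖ x → ¬ IsMin q := fun q hq h => hbad ⟨q, h, hq⟩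
  -- No lower cover of `x` is minimal, so they are pairwise comparable; hence there is only one.
  have hlt : ∀ z, z < x → z ≤ p := by
    intro z hz
    obtain ⟨q, hzq, hq⟩ := exists_covBy_of_lt hz
    rcases hN q p (hpmin q hq) (hpmin p hp) with h | h
    · exact hzq.trans h
    · rcases h.eq_or_lt with rfl | h
      exacts [hzq, (hp.2 h hq.lt).elim]
  obtain ⟨c, hc⟩ := not_isMin_iff.1 (hpmin p hp)
  rcases (ht x).eq_or_lt with rfl | hxt
  · exact h1 (exists_biPMorphism_F1 ht hp.lt hlt hc)
  · obtain ⟨y, hxy, -⟩ := exists_covBy_of_lt' hxt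
    have hy : ∃ m, IsMin m ∧ m ⋖ y := by
      by_contra hy
      exact hxy.lt.not_ge (hmax ⟨fun h => hxy.lt.not_ge (h hxy.le), hy⟩ hxy.le)
    obtain ⟨m, hm, hmy⟩ := hy
    exact h2 (exists_biPMorphism_F2 ht hX hN hp.lt hlt hc hxy hm hmy)

/-- The increasing enumeration of the elements which are not minimal. -/
theorem exists_enumeration (hN : ∀ x y : X, ¬ IsMin x → ¬ IsMin y → x ≤ y ∨ y ≤ x) :
    ∃ (n : ℕ) (s : Fin n ↪o X), ∀ x, ¬ IsMin x ↔ ∃ i, s i = x := by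
  classical
  let N := {x : X // ¬ IsMin x}
  let _ : LinearOrder N :=
    { (inferInstance : PartialOrder N) with
      le_total := fun x y => hN x y x.2 y.2
      toDecidableLE := Classical.decRel _ }
  have := Fintype.ofFinite N
  let e : Fin (Fintype.card N) ≃o N := Fintype.orderIsoFinOfCardEq N rfl
  refine ⟨_, e.toOrderEmbedding.trans (OrderEmbedding.subtype _), fun x => ⟨fun hx => ?_, ?_⟩⟩
  · exact ⟨e.symm ⟨x, hx⟩, congrArg Subtype.val (e.apply_symm_apply ⟨x, hx⟩)⟩
  · rintro ⟨i, rfl⟩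
    exact (e i).2

/-- The enumerated non-minimal points `s i` form the spine and chosen minimal lower covers `τ i` the
teeth. The covering relation forces the comb order on them, so only the minimal points that are not
chosen remain to be located. -/
theorem comb_or_hcomb (ht : ∀ x, x ≤ t)
    (hX : ∀ x y z : X, x ≤ y → x ≤ z → y ≤ z ∨ z ≤ y)
    (hN : ∀ x y : X, ¬ IsMin x → ¬ IsMin y → x ≤ y ∨ y ≤ x)
    (h1 : ¬ ∃ f : X → F1, IsBiPMorphism f ∧ Function.Surjective f)
    (h2 : ¬ ∃ f : X → F2, IsBiPMorphism f ∧ Function.Surjective f)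
    (h3 : ¬ ∃ f : X → F3, IsBiPMorphism f ∧ Function.Surjective f) :
    (∃ n, 0 < n ∧ Nonempty (X ≃o Comb n)) ∨ ∃ n, Nonempty (X ≃o HComb n) := by
  obtain ⟨n, s, hs⟩ := exists_enumeration hN
  have hsN : ∀ i, ¬ IsMin (s i) := fun i => (hs _).2 ⟨i, rfl⟩
  choose τ hτ hτs using fun i => exists_isMin_covBy ht hX hN h1 h2 (s i) (hsN i)
  have hmin : ∀ {x y : X}, IsMin y → x ≤ y → x = y := fun h hxy => le_antisymm hxy (h hxy)
  have hss : ∀ i j, s i ≤ s j ↔ i ≤ j := fun i j => s.le_iff_le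
  have hts : ∀ i j, τ i ≤ s j ↔ i ≤ j := by
    refine fun i j => ⟨fun h => not_lt.1 fun hji => ?_, fun h => (hτs i).le.trans ((hss i j).2 h)⟩
    exact (hτs i).2 (h.lt_of_ne fun e => hsN j (e ▸ hτ i)) (s.lt_iff_lt.2 hji)
  have hst : ∀ i y, IsMin y → ¬ s i ≤ y := fun i y hy h => hsN i (hmin hy h ▸ hy)
  have htt : ∀ i j, τ i ≤ τ j ↔ i = j := by
    refine fun i j => ⟨fun h => ?_, fun h => h ▸ le_rfl⟩
    have e := hmin (hτ j) h
    exact le_antisymm ((hts i j).1 (e ▸ (hτs j).le)) ((hts j i).1 (e ▸ (hτs i).le))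
  by_cases hm : ∃ m, IsMin m ∧ ∀ i, τ i ≠ m
  · obtain ⟨m, hm, hmτ⟩ := hm
    -- A leftover minimal point `m ≠ t` is covered by the lowest spine point: if its cover `s i` had
    -- a spine point below it, then `m`, `τ i` and a lower cover of `s i` above that spine point
    -- would be three lower covers, giving a map onto `F3`.
    have hcov : ∀ m, IsMin m → (∀ i, τ i ≠ m) → m ≠ t → ∃ i, m ⋖ s i ∧ ∀ j, i ≤ j := by
      intro m hm hmτ hmt
      obtain ⟨x, hx, -⟩ := exists_covBy_of_lt' ((ht m).lt_of_ne hmt)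
      obtain ⟨i, rfl⟩ := (hs x).1 fun h => hx.lt.not_ge (h hx.le)
      refine ⟨i, hx, fun j => not_lt.1 fun hji => ?_⟩
      obtain ⟨q, hjq, hq⟩ := exists_covBy_of_lt (s.lt_iff_lt.2 hji)
      exact h3 (exists_biPMorphism_F3 ht hX hx (hτs i) hq (hmτ i).symm
        (fun e => hst j m hm (e ▸ hjq)) (fun e => hst j _ (hτ i) (e ▸ hjq)))
    have hms : ∀ i, m ≤ s i := by
      intro i
      have hmt : m ≠ t := fun e => hst i m hm (e ▸ ht _)
      obtain ⟨j, hj, hjmin⟩ := hcov m hm hmτ hmt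
      exact hj.le.trans ((hss j i).2 (hjmin i))
    -- Two leftover points and the tooth would be three lower covers of the lowest spine point.
    have huniq : ∀ m', IsMin m' → (∀ i, τ i ≠ m') → m' = m := by
      intro m' hm' hmτ'
      by_cases hmt : m = t
      · exact hmin hm (hmt ▸ ht m')
      by_cases hmt' : m' = t
      · exact (hmin hm' (hmt' ▸ ht m)).symm
      obtain ⟨i, hi, himin⟩ := hcov m hm hmτ hmt
      obtain ⟨j, hj, hjmin⟩ := hcov m' hm' hmτ' hmt'
      cases le_antisymm (himin j) (hjmin i)
      by_contra hne
      exact h3 (exists_biPMorphism_F3 ht hX hi hj (hτs i) (Ne.symm hne) (hmτ i).symm (hmτ' i).symm)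
    right
    -- The leftover point plays the role of `y_0`, which has no tooth, so the spine is shifted by
    -- one. For `n = 0` this is the one-point poset.
    let g : HComb n → X
      | .spine i => Fin.cases m s i
      | .tooth i => τ i
    refine ⟨n, nonempty_orderIso_of_surjective g (fun x => ?_) fun a b => ?_⟩
    · by_cases hx : IsMin x
      · by_cases hxm : x = m
        · exact ⟨.spine 0, hxm.symm⟩
        · obtain ⟨i, hi⟩ : ∃ i, τ i = x := by
            by_contra! h
            exact hxm (huniq x hx h)
          exact ⟨.tooth i, hi⟩
      · obtain ⟨i, hi⟩ := (hs x).1 hx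
        exact ⟨.spine i.succ, hi⟩
    · cases a with
      | spine i => cases b with
        | spine j =>
          rw [HComb.spine_le_spine]
          cases i using Fin.cases with
          | zero => cases j using Fin.cases with
            | zero => exact iff_of_true le_rfl le_rfl
            | succ j => exact iff_of_true (hms j) (Fin.zero_le _)
          | succ i => cases j using Fin.cases with
            | zero => exact iff_of_false (hst i m hm) (Fin.succ_pos i).not_ge
            | succ j => exact (hss i j).trans Fin.succ_le_succ_iff.symm
        | tooth j => cases i using Fin.cases with
          | zero => exact iff_of_false (fun h => hmτ j (hmin (hτ j) h).symm) HComb.not_spine_le_tooth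
          | succ i => exact iff_of_false (hst i _ (hτ j)) HComb.not_spine_le_tooth
      | tooth i => cases b with
        | spine j =>
          rw [HComb.tooth_le_spine]
          cases j using Fin.cases with
          | zero => exact iff_of_false (fun h => hmτ i (hmin hm h)) (Fin.succ_pos i).not_ge
          | succ j => exact (hts i j).trans Fin.succ_le_succ_iff.symm
        | tooth j => exact htt i j
  · push Not at hm
    left
    let g : Comb n → X
      | .spine i => s i
      | .tooth i => τ i
    refine ⟨n, ?_, nonempty_orderIso_of_surjective g (fun x => ?_) fun a b => ?_⟩
    -- The point `t` itself, whether a tooth or a spine point, supplies an index, so `n` is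
    -- positive.
    · by_cases h : IsMin t
      · obtain ⟨i, -⟩ := hm t h
        exact i.pos
      · obtain ⟨i, -⟩ := (hs t).1 h
        exact i.pos
    · by_cases hx : IsMin x
      · obtain ⟨i, hi⟩ := hm x hx
        exact ⟨.tooth i, hi⟩
      · obtain ⟨i, hi⟩ := (hs x).1 hx
        exact ⟨.spine i, hi⟩
    · cases a with
      | spine i => cases b with
        | spine j => exact hss i j
        | tooth j => exact iff_of_false (hst i _ (hτ j)) Comb.not_spine_le_tooth
      | tooth i => cases b with
        | spine j => exact hts i j
        | tooth j => exact htt i j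

end Cotree

/-! ### The classification -/

/-- The finite subdirectly irreducible members of the variety of `LFC` are dual to combs and
hcombs. -/
theorem dual_comb_or_hcomb {A : Type u} [BiheytingAlgebra A] (h : InFinSI LFC A) :
    (∃ n, 0 < n ∧ Nonempty (Dual A ≃o Comb n)) ∨ ∃ n, Nonempty (Dual A ≃o HComb n) := by
  have := h.2.2
  obtain ⟨hL, hSI, -⟩ := h.of_orderIso Dual.orderIsoUp
  obtain ⟨hGD, hS⟩ := inVariety_extend_iff.1 hL
  have hX := inVariety_biGD_up_iff.1 hGD
  obtain ⟨t, ht⟩ := exists_greatest_of_isSI hX hSI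
  exact comb_or_hcomb ht hX
    (not_isMin_comparable ht hX (hS _ (.inl rfl)))
    ((valid_jankov_iff ht).1 (hS _ (.inr (.inl rfl))))
    ((valid_jankov_iff ht).1 (hS _ (.inr (.inr (.inl rfl)))))
    ((valid_jankov_iff ht).1 (hS _ (.inr (.inr (.inr rfl)))))

end BiInt

theorem mainTheorem6 (A : Type u) [BiheytingAlgebra A] :
    (BiInt.InFinSI BiInt.LogFC A ↔ BiInt.InFinSI BiInt.LFC A) ∧
    (BiInt.InFinSI BiInt.LogFC A ↔
      (∃ n : ℕ, 0 < n ∧ BiInt.Isomorphic (BiInt.Dual A) (BiInt.Comb n)) ∨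
      (∃ n : ℕ, BiInt.Isomorphic (BiInt.Dual A) (BiInt.HComb n))) := by
  simp only [BiInt.isomorphic_dual_iff]
  have h₁ : BiInt.InFinSI BiInt.LogFC A → BiInt.InFinSI BiInt.LFC A :=
    fun h => ⟨fun φ hφ => h.1 φ (BiInt.LFC_subset_LogFC hφ), h.2⟩
  have h₂ := BiInt.dual_comb_or_hcomb (A := A)
  have h₃ : ((∃ n : ℕ, 0 < n ∧ Nonempty (BiInt.Dual A ≃o BiInt.Comb n)) ∨
      ∃ n : ℕ, Nonempty (BiInt.Dual A ≃o BiInt.HComb n)) → BiInt.InFinSI BiInt.LogFC A := by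
    rintro (⟨n, hn, ⟨e⟩⟩ | ⟨n, ⟨e⟩⟩)
    · have : Finite (BiInt.Dual A) := .of_equiv _ e.symm.toEquiv
      exact (BiInt.inFinSI_LogFC_comb hn).of_orderIso
        (BiInt.Dual.orderIsoUp.trans (BiInt.Up.congr e)).symm
    · have : Finite (BiInt.Dual A) := .of_equiv _ e.symm.toEquiv
      exact (BiInt.inFinSI_LogFC_hcomb n).of_orderIso
        (BiInt.Dual.orderIsoUp.trans (BiInt.Up.congr e)).symm
  exact ⟨⟨h₁, fun h => h₃ (h₂ h)⟩, fun h => h₂ (h₁ h), h₃⟩
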